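/- **Jacobi matrices.** Let $G$ be a connected graph of bounded degree. A (bounded) Jacobi matrix $H$ on $G$ is given by bounded weights $a_{u,v}=a_{v,u}\in[0,\infty)$ for $u\sim v$ and a bounded function $b:V(G)\to\mathbb{R}$; it acts on $\psi\in\ell^2(V(G))$ by $(H\psi)(v)=\sum_{u\sim v}a_{u,v}\psi(u)+b(v)\psi(v)$. Its essential spectrum is $\sigma_{\mathrm{ess}}(H)=\sigma(H)\setminus\sigma_{\mathrm{discrete}}(H)$, where $\sigma_{\mathrm{discrete}}(H)$ is the set of isolated points of $\sigma(H)$ that are eigenvalues of finite multiplicity. **$\mathcal{R}$-limits.** For $v\in V(G)$ and $r\in\mathbb{N}$ let $B_r(v)$ be the ball of radius $r$ around $v$ and $N_{v,r}=|B_r(v)|$. A coherent enumeration at $v$ is a sequence of bijections $\eta_r:B_r(v)\to\{1,\dots,N_{v,r}\}$, $r\ge 1$, with $\eta_s|_{B_r(v)}=\eta_r$ whenever $r<s$; let $M^{(v)}_r$ be the matrix of the restriction of $H$ to $\ell^2(B_r(v))$ in the enumeration $\eta_r$. Let $H'$ be a Jacobi matrix on a connected graph $G'$ of bounded degree and let $v_0'\in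 V(G')$. Then $\{H',G',v_0'\}$ is an $\mathcal{R}$-limit of $H$ if there are a sequence of vertices $(v_n)$ of $G$ whose distance from a fixed vertex tends to infinity, a subsequence $(v_{n_j})$, coherent enumerations at each $v_{n_j}$ and a coherent enumeration at $v_0'$, such that for every $r\ge1$ one has $N_{v_{n_j},r}=N_{v_0',r}$ for all sufficiently large $j$ and $\lim_{j\to\infty}M^{(v_{n_j})}_r=M^{(v_0')}_r$. **Theorem.** Let $H$ be a bounded Jacobi matrix on $\ell^2(T)$, where $T$ is a regular tree of finite degree. Then $$\sigma_{\mathrm{ess}}(H)=\overline{\bigcup_{L\text{ is an }\mathcal{R}\text{-limit of }H}\sigma(L)}.$$ If moreover $\inf_{u\sim v}a_{u,v}>0$, then the same equality holds with the union restricted to the $\mathcal{R}$-limits $L$ all of whose weights are strictly positive. -/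

import Mathlib

open Filter Topology
open scoped lp ENNReal

universe u w

noncomputable section

/-! ### Essential spectrum -/

/-- The discrete spectrum of a bounded operator: the isolated points of the spectrum which are
eigenvalues of finite multiplicity. -/
def discreteSpectrum {E : Type*} [NormedAddCommGroup E] [NormedSpace ℂ E] (A : E →L[ℂ] E) :
    Set ℂ :=
  {z | z ∈ spectrum ℂ A ∧
    (∃ ε > 0, ∀ z' ∈ spectrum ℂ A, dist z' z < ε → z' = z) ∧
    Module.End.HasEigenvalue (A : E →ₗ[ℂ] E) z ∧
    FiniteDimensional ℂ (Module.End.eigenspace (A : E →ₗ[ℂ] E) z)}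

/-- The essential spectrum: the spectrum with the discrete spectrum removed. -/
def essentialSpectrum {E : Type*} [NormedAddCommGroup E] [NormedSpace ℂ E] (A : E →L[ℂ] E) :
    Set ℂ :=
  spectrum ℂ A \ discreteSpectrum A

/-! ### Jacobi matrices on graphs -/

/-- The degrees of the vertices of `G` are bounded by one constant. -/
def HasBoundedDegree {V : Type u} (G : SimpleGraph V) [G.LocallyFinite] : Prop :=
  ∃ D : ℕ, ∀ v, G.degree v ≤ D

/-- The coefficients of a bounded Jacobi matrix on a graph. Only the values `a u v` with `u ~ v`
matter. The weights are allowed to vanish, so that the class is closed under limits. -/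
structure JacobiMatrix {V : Type u} (G : SimpleGraph V) where
  a : V → V → ℝ
  b : V → ℝ
  a_symm : ∀ u v, G.Adj u v → a u v = a v u
  a_nonneg : ∀ u v, G.Adj u v → 0 ≤ a u v
  a_bounded : ∃ C : ℝ, ∀ u v, G.Adj u v → a u v ≤ C
  b_bounded : ∃ C : ℝ, ∀ v, |b v| ≤ C

namespace JacobiMatrix

variable {V : Type u} {G : SimpleGraph V}

/-- All edge weights are strictly positive. -/
def Positive (J : JacobiMatrix G) : Prop := ∀ u v, G.Adj u v → 0 < J.a u v

/-- The pointwise action `(H ψ)(v) = ∑_{u ~ v} a_{u,v} ψ(u) + b(v) ψ(v)`. -/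
def act [G.LocallyFinite] (J : JacobiMatrix G) (ψ : V → ℂ) (v : V) : ℂ :=
  ∑ u ∈ G.neighborFinset v, (J.a u v : ℂ) * ψ u + (J.b v : ℂ) * ψ v

theorem exists_act_bound [G.LocallyFinite] (J : JacobiMatrix G) (hG : HasBoundedDegree G) :
    ∃ K : ℝ, 0 ≤ K ∧ ∀ (ψ : ℓ²(V, ℂ)) (s : Finset V),
      ∑ v ∈ s, ‖J.act ψ v‖ ^ (2 : ℝ≥0∞).toReal ≤ (K * ‖ψ‖) ^ (2 : ℝ≥0∞).toReal := by
  classical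
  obtain ⟨D, hD⟩ := hG
  obtain ⟨A, hA⟩ := J.a_bounded
  obtain ⟨B, hB⟩ := J.b_bounded
  refine ⟨Real.sqrt (2 * D * A ^ 2 * D + 2 * B ^ 2), Real.sqrt_nonneg _, fun ψ s => ?_⟩
  have hp : (2 : ℝ≥0∞).toReal = ((2 : ℕ) : ℝ) := by simp
  simp only [hp, Real.rpow_natCast]
  rw [mul_pow, Real.sq_sqrt (by positivity)]
  have hsum : ∀ t : Finset V, ∑ u ∈ t, ‖ψ u‖ ^ 2 ≤ ‖ψ‖ ^ 2 := by
    intro t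
    have := lp.sum_rpow_le_norm_rpow (p := 2) (by simp) ψ t
    simpa only [hp, Real.rpow_natCast] using this
  have hpt : ∀ v, ‖J.act ψ v‖ ^ 2 ≤
      2 * D * A ^ 2 * ∑ u ∈ G.neighborFinset v, ‖ψ u‖ ^ 2 + 2 * B ^ 2 * ‖ψ v‖ ^ 2 := by
    intro v
    have h1 : ‖∑ u ∈ G.neighborFinset v, (J.a u v : ℂ) * ψ u‖ ^ 2 ≤
        D * (A ^ 2 * ∑ u ∈ G.neighborFinset v, ‖ψ u‖ ^ 2) := by
      calc ‖∑ u ∈ G.neighborFinset v, (J.a u v : ℂ) * ψ u‖ ^ 2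
          ≤ (∑ u ∈ G.neighborFinset v, ‖(J.a u v : ℂ) * ψ u‖) ^ 2 := by
            exact pow_le_pow_left₀ (norm_nonneg _) (norm_sum_le _ _) 2
        _ ≤ (G.neighborFinset v).card * ∑ u ∈ G.neighborFinset v, ‖(J.a u v : ℂ) * ψ u‖ ^ 2 :=
            sq_sum_le_card_mul_sum_sq
        _ ≤ D * (A ^ 2 * ∑ u ∈ G.neighborFinset v, ‖ψ u‖ ^ 2) := by
            refine mul_le_mul (by exact_mod_cast hD v) ?_ (by positivity) (by positivity)
            rw [Finset.mul_sum]
            refine Finset.sum_le_sum fun u hu => ?_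
            have hadj : G.Adj u v := by
              rw [SimpleGraph.mem_neighborFinset] at hu; exact hu.symm
            rw [norm_mul, mul_pow, Complex.norm_real, Real.norm_eq_abs, sq_abs]
            exact mul_le_mul_of_nonneg_right
              (pow_le_pow_left₀ (J.a_nonneg u v hadj) (hA u v hadj) 2) (by positivity)
    have h2 : ‖(J.b v : ℂ) * ψ v‖ ^ 2 ≤ B ^ 2 * ‖ψ v‖ ^ 2 := by
      rw [norm_mul, mul_pow, Complex.norm_real, Real.norm_eq_abs]
      exact mul_le_mul_of_nonneg_right (pow_le_pow_left₀ (abs_nonneg _) (hB v) 2) (by positivity)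
    have h3 := norm_add_le (∑ u ∈ G.neighborFinset v, (J.a u v : ℂ) * ψ u) ((J.b v : ℂ) * ψ v)
    have h4 : ‖J.act ψ v‖ ^ 2 ≤ (‖∑ u ∈ G.neighborFinset v, (J.a u v : ℂ) * ψ u‖ +
        ‖(J.b v : ℂ) * ψ v‖) ^ 2 := by
      exact pow_le_pow_left₀ (norm_nonneg _) h3 2
    have h5 := add_sq_le (a := ‖∑ u ∈ G.neighborFinset v, (J.a u v : ℂ) * ψ u‖)
      (b := ‖(J.b v : ℂ) * ψ v‖)
    linarith
  have hdouble : ∑ v ∈ s, ∑ u ∈ G.neighborFinset v, ‖ψ u‖ ^ 2 ≤ D * ‖ψ‖ ^ 2 := by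
    have hcomm : ∑ v ∈ s, ∑ u ∈ G.neighborFinset v, ‖ψ u‖ ^ 2 =
        ∑ u ∈ s.biUnion (fun v => G.neighborFinset v), ∑ v ∈ s with G.Adj u v, ‖ψ u‖ ^ 2 := by
      apply Finset.sum_comm'
      intro x y
      simp only [SimpleGraph.mem_neighborFinset, Finset.mem_biUnion, Finset.mem_filter]
      constructor
      · rintro ⟨h1, h2⟩; exact ⟨⟨h1, h2.symm⟩, x, h1, h2⟩
      · rintro ⟨⟨h1, h2⟩, -⟩; exact ⟨h1, h2.symm⟩
    rw [hcomm]
    calc _ ≤ ∑ u ∈ s.biUnion (fun v => G.neighborFinset v), D * ‖ψ u‖ ^ 2 := by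
          apply Finset.sum_le_sum
          intro u _
          rw [Finset.sum_const, nsmul_eq_mul]
          gcongr
          refine le_trans (Finset.card_le_card ?_) (hD u)
          intro v hv
          rw [Finset.mem_filter] at hv
          rw [SimpleGraph.mem_neighborFinset]
          exact hv.2
      _ ≤ D * ‖ψ‖ ^ 2 := by
          rw [← Finset.mul_sum]
          gcongr
          exact hsum _
  calc ∑ v ∈ s, ‖J.act ψ v‖ ^ 2
      ≤ ∑ v ∈ s, (2 * D * A ^ 2 * ∑ u ∈ G.neighborFinset v, ‖ψ u‖ ^ 2
          + 2 * B ^ 2 * ‖ψ v‖ ^ 2) := Finset.sum_le_sum fun v _ => hpt v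
    _ = 2 * D * A ^ 2 * ∑ v ∈ s, ∑ u ∈ G.neighborFinset v, ‖ψ u‖ ^ 2
          + 2 * B ^ 2 * ∑ v ∈ s, ‖ψ v‖ ^ 2 := by
        rw [Finset.sum_add_distrib, ← Finset.mul_sum, ← Finset.mul_sum]
    _ ≤ 2 * D * A ^ 2 * (D * ‖ψ‖ ^ 2) + 2 * B ^ 2 * ‖ψ‖ ^ 2 := by
        gcongr
        exact hsum s
    _ = (2 * D * A ^ 2 * D + 2 * B ^ 2) * ‖ψ‖ ^ 2 := by ring

theorem act_memℓp [G.LocallyFinite] (J : JacobiMatrix G) (hG : HasBoundedDegree G)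
    (ψ : ℓ²(V, ℂ)) : Memℓp (J.act ψ) 2 := by
  obtain ⟨K, _, hK⟩ := J.exists_act_bound hG
  exact memℓp_gen' (hK ψ)

/-- The Jacobi operator on `ℓ²(V)`. -/
def op [G.LocallyFinite] (J : JacobiMatrix G) (hG : HasBoundedDegree G) :
    ℓ²(V, ℂ) →L[ℂ] ℓ²(V, ℂ) :=
  LinearMap.mkContinuousOfExistsBound
    { toFun := fun ψ => ⟨J.act ψ, J.act_memℓp hG ψ⟩
      map_add' := by
        intro ψ φ
        ext v
        simp only [act, lp.coeFn_add, Pi.add_apply, mul_add, Finset.sum_add_distrib]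
        ring
      map_smul' := by
        intro c ψ
        ext v
        simp only [act, lp.coeFn_smul, Pi.smul_apply, smul_eq_mul, RingHom.id_apply, mul_add,
          Finset.mul_sum]
        congr 1
        · exact Finset.sum_congr rfl fun u _ => by ring
        · ring }
    (by
      obtain ⟨K, hK0, hK⟩ := J.exists_act_bound hG
      exact ⟨K, fun ψ => lp.norm_le_of_forall_sum_le (by simp) (by positivity) (hK ψ)⟩)

@[simp]
theorem op_apply [G.LocallyFinite] (J : JacobiMatrix G) (hG : HasBoundedDegree G)
    (ψ : ℓ²(V, ℂ)) (v : V) :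
    J.op hG ψ v = ∑ u ∈ G.neighborFinset v, (J.a u v : ℂ) * ψ u + (J.b v : ℂ) * ψ v := rfl

open Classical in
/-- The matrix entry `⟨δ_u, H δ_v⟩`. -/
def entry (J : JacobiMatrix G) (u v : V) : ℝ :=
  if u = v then J.b u else if G.Adj u v then J.a u v else 0

end JacobiMatrix

/-! ### Balls and coherent enumerations -/

/-- The closed ball `B_r(v)` of a connected graph. -/
def graphBall {V : Type u} (G : SimpleGraph V) (v : V) (r : ℕ) : Set V := {u | G.dist u v ≤ r}

/-- The number of vertices in `B_r(v)`. -/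
def ballCard {V : Type u} (G : SimpleGraph V) (v : V) (r : ℕ) : ℕ := Nat.card (graphBall G v r)

/-- A coherent sequence of enumerations of the balls `B_r(v)`, `r = 1, 2, …`, by
`0, …, N_{v,r} - 1`. The enumeration of `B_0(v)` carries no condition. -/
structure CoherentEnumeration {V : Type u} (G : SimpleGraph V) (v : V) where
  η : ∀ r : ℕ, graphBall G v r ≃ Fin (ballCard G v r)
  coherent : ∀ r s : ℕ, 1 ≤ r → r < s → ∀ (x : V) (hr : x ∈ graphBall G v r)
    (hs : x ∈ graphBall G v s), (η s ⟨x, hs⟩ : ℕ) = (η r ⟨x, hr⟩ : ℕ)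

namespace JacobiMatrix

variable {V : Type u} {G : SimpleGraph V} {V' : Type w} {G' : SimpleGraph V'}

/-- The matrix of the restriction of `J` to `B_r(v)` in the enumeration `e.η r`. -/
def ballMatrix (J : JacobiMatrix G) {v : V} (e : CoherentEnumeration G v) (r : ℕ) :
    Matrix (Fin (ballCard G v r)) (Fin (ballCard G v r)) ℝ :=
  Matrix.of fun i k => J.entry ((e.η r).symm i : V) ((e.η r).symm k : V)

/-- `{J', G', v₀'}` is an R-limit of `J` along the sequence of vertices `v`: along a subsequence,
for every `r` the balls eventually have the same number of vertices and the ball matrices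
converge (entrywise, equivalently in any matrix norm). -/
def IsRLimitAlong (J : JacobiMatrix G) (v : ℕ → V) (J' : JacobiMatrix G') (v₀' : V') : Prop :=
  ∃ n : ℕ → ℕ, StrictMono n ∧
    ∃ (e : ∀ j, CoherentEnumeration G (v (n j))) (e' : CoherentEnumeration G' v₀'),
      ∀ r : ℕ, 1 ≤ r → ∀ ε : ℝ, 0 < ε → ∀ᶠ j in atTop,
        ∃ h : ballCard G' v₀' r = ballCard G (v (n j)) r,
          ∀ i k : Fin (ballCard G' v₀' r),
            |J.ballMatrix (e j) r (Fin.cast h i) (Fin.cast h k) - J'.ballMatrix e' r i k| < ε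

/-- `{J', G', v₀'}` is an R-limit of `J`: it is one along some sequence of vertices whose distance
from a fixed root tends to infinity. -/
def IsRLimit (J : JacobiMatrix G) (J' : JacobiMatrix G') (v₀' : V') : Prop :=
  ∃ v : ℕ → V, (∃ o : V, Tendsto (fun j => G.dist (v j) o) atTop atTop) ∧
    J.IsRLimitAlong v J' v₀'

/-- The union of the spectra of all R-limits of `J`; these live on connected graphs of bounded
degree. -/
def rLimitSpectra (J : JacobiMatrix G) : Set ℂ :=
  {z | ∃ (W : Type u) (F : SimpleGraph W) (_ : F.LocallyFinite) (hF : HasBoundedDegree F)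
    (L : JacobiMatrix F) (w₀ : W), F.Connected ∧ J.IsRLimit L w₀ ∧ z ∈ spectrum ℂ (L.op hF)}

/-- The union of the spectra of those R-limits of `J` all of whose edge weights are strictly
positive. -/
def positiveRLimitSpectra (J : JacobiMatrix G) : Set ℂ :=
  {z | ∃ (W : Type u) (F : SimpleGraph W) (_ : F.LocallyFinite) (hF : HasBoundedDegree F)
    (L : JacobiMatrix F) (w₀ : W), F.Connected ∧ L.Positive ∧ J.IsRLimit L w₀ ∧
      z ∈ spectrum ℂ (L.op hF)}

end JacobiMatrix

end

/-! Both inclusions go through a form of Weyl's criterion, `mem_essentialSpectrum_iff`: a point z is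
in the essential spectrum iff there are finitely supported approximate eigenvectors that avoid any
prescribed finite set of vertices. Since the operators are self-adjoint, an approximate eigenvector
with relative error ε also forces a spectral point within ε of z (`exists_mem_spectrum_dist_le`).

For the spectra of R-limits, an approximate eigenvector of the limit is truncated to finite support
and copied by `exists_transport` to a far away ball of T whose matrix is close to that of the limit.
The essential spectrum is thereby seen to contain the closure as well.

The converse needs approximate eigenvectors supported in balls of a fixed radius. Cutting off to
balls is costly on a regular tree, where boundaries can be as large as the balls. Instead a root is
fixed, and for each w the cutoff is the indicator of the vertices having w among their first R
ancestors, themselves included. A vertex far from the root lies in exactly R of these sets, whereas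
along an edge at most two of the indicators change. Summed over w, the squared masses give R‖ψ‖²,
while the commutator errors contribute a bound independent of R. Hence some cutoff has relative
squared error at most 2ε² + O(1/R); this is `exists_localized`.

The centres w of the localized vectors tend to infinity. A regular tree is homogeneous
(`IsTree.exists_iso`), so automorphisms bring the centres back to the root, and compactness of the
bounded coefficients gives a limit matrix L on T itself (`exists_tendsto_translates`). Transporting
a localized vector to L yields spectrum of L near z. A lower bound on the weights survives the
limit, which settles the positive case. -/

section NormalOperators

/-! ### Normal operators: approximate eigenvectors and isolated spectrum. -/

theorem IsStarNormal.sub_algebraMap {A : Type*} [Ring A] [StarRing A] [Algebra ℂ A]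
    [StarModule ℂ A] {a : A} (ha : IsStarNormal a) (z : ℂ) :
    IsStarNormal (a - algebraMap ℂ A z) := by
  constructor
  rw [star_sub, ← algebraMap_star_comm]
  exact ((ha.star_comm_self.sub_left (Algebra.commutes _ _)).sub_right
    ((Algebra.commutes _ _).symm))

variable {E : Type*} [NormedAddCommGroup E] [InnerProductSpace ℂ E] [CompleteSpace E]

/-- A normal operator which is bounded below is invertible. -/
theorem ContinuousLinearMap.isUnit_of_isStarNormal_of_le {T : E →L[ℂ] E} (hT : IsStarNormal T)
    {c : ℝ} (hc : 0 < c) (h : ∀ x, c * ‖x‖ ≤ ‖T x‖) : IsUnit T := by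
  rw [ContinuousLinearMap.isUnit_iff_bijective,
    ContinuousLinearMap.bijective_iff_dense_range_and_antilipschitz]
  refine ⟨?_, ⟨⟨c⁻¹, by positivity⟩, T.antilipschitz_of_bound fun x => ?_⟩⟩
  -- The complement of the range is the kernel of the adjoint, which normality identifies with the
  -- kernel of `T`.
  · rw [Submodule.topologicalClosure_eq_top_iff, ContinuousLinearMap.orthogonal_range,
      Submodule.eq_bot_iff]
    intro x hx
    have h1 : ContinuousLinearMap.adjoint T x = 0 := hx
    have h2 : ‖T x‖ = ‖ContinuousLinearMap.adjoint T x‖ :=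
      ContinuousLinearMap.isStarNormal_iff_norm_eq_adjoint.1 hT x
    have h3 := h x
    rw [h2, h1, norm_zero] at h3
    have : ‖x‖ ≤ 0 := by
      by_contra hn
      push Not at hn
      nlinarith
    simpa using this
  · change ‖x‖ ≤ c⁻¹ * ‖T x‖
    rw [inv_mul_eq_div, le_div_iff₀ hc, mul_comm]
    exact h x

/-- Points of the spectrum of a normal operator are approximate eigenvalues. -/
theorem exists_approx_eigenvector {A : E →L[ℂ] E} (hA : IsStarNormal A) {z : ℂ}
    (hz : z ∈ spectrum ℂ A) {ε : ℝ} (hε : 0 < ε) : ∃ x, ‖A x - z • x‖ < ε * ‖x‖ := by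
  by_contra! h
  rw [spectrum.mem_iff, ← IsUnit.neg_iff, neg_sub] at hz
  exact hz (ContinuousLinearMap.isUnit_of_isStarNormal_of_le (hA.sub_algebraMap z) hε
    fun x => by simpa [Algebra.algebraMap_eq_smul_one] using h x)

theorem mem_spectrum_of_approx {E : Type*} [NormedAddCommGroup E] [InnerProductSpace ℂ E]
    {A : E →L[ℂ] E} {z : ℂ} (h : ∀ ε > 0, ∃ x, x ≠ 0 ∧ ‖A x - z • x‖ ≤ ε * ‖x‖) : z ∈ spectrum ℂ A := by
  rw [spectrum.mem_iff, ← IsUnit.neg_iff, neg_sub]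
  rintro ⟨U, hU⟩
  -- With this error, applying the inverse would give ‖x‖ ≤ ‖x‖ / 2.
  obtain ⟨x, hx0, hx⟩ := h (2 * (‖(↑U⁻¹ : E →L[ℂ] E)‖ + 1))⁻¹ (by positivity)
  have h1 : (↑U⁻¹ : E →L[ℂ] E) (A x - z • x) = x := by
    have h2 : A x - z • x = (U : E →L[ℂ] E) x := by
      rw [hU]; simp [Algebra.algebraMap_eq_smul_one]
    rw [h2, ← mul_apply_eq_comp, Units.inv_mul, one_apply_eq_self]
  have h3 := (↑U⁻¹ : E →L[ℂ] E).le_opNorm (A x - z • x)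
  rw [h1] at h3
  have hxp : 0 < ‖x‖ := norm_pos_iff.2 hx0
  set n := ‖(↑U⁻¹ : E →L[ℂ] E)‖
  have hn : 0 ≤ n := norm_nonneg _
  have h4 : n * ‖A x - z • x‖ ≤ n * ((2 * (n + 1))⁻¹ * ‖x‖) := by gcongr
  have h5 : n * ((2 * (n + 1))⁻¹ * ‖x‖) = (n / (2 * (n + 1))) * ‖x‖ := by ring
  have h6 : n / (2 * (n + 1)) ≤ 1 / 2 := by
    rw [div_le_div_iff₀ (by positivity) (by norm_num)]; linarith
  nlinarith

/-- The function (x - z)⁻¹ takes the value 0 at x = z, so when z is isolated its functional calculus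
is the reduced resolvent: it inverts `A - z` off the eigenspace. When z is outside the spectrum it
is the resolvent. -/
theorem cfc_sub_mul_inv {A : E →L[ℂ] E} (hA : IsStarNormal A) {z : ℂ}
    (hc : ContinuousOn (fun x : ℂ => (x - z)⁻¹) (spectrum ℂ A)) :
    (A - algebraMap ℂ _ z) * (cfc (fun x : ℂ => (x - z)⁻¹) A * (A - algebraMap ℂ _ z)) =
      A - algebraMap ℂ _ z ∧
    (z ∉ spectrum ℂ A → cfc (fun x : ℂ => (x - z)⁻¹) A * (A - algebraMap ℂ _ z) = 1) := by
  have h1 : cfc (fun x : ℂ => x - z) A = A - algebraMap ℂ _ z := by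
    rw [cfc_sub .., cfc_id' .., cfc_const ..]
  rw [← h1]
  have h2 := cfc_mul (fun x : ℂ => (x - z)⁻¹) (fun x : ℂ => x - z) A
  have hc' : ContinuousOn (fun x : ℂ => (x - z)⁻¹ * (x - z)) (spectrum ℂ A) :=
    hc.mul (by fun_prop)
  refine ⟨?_, fun hz => ?_⟩
  · rw [← h2, ← cfc_mul ..]
    refine cfc_congr fun x _ => ?_
    rcases eq_or_ne (x - z) 0 with h | h
    · simp [h]
    · field_simp
  · rw [← h2, ← cfc_const_one ℂ A]
    refine cfc_congr fun x hx => ?_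
    have h : x - z ≠ 0 := by
      intro h; rw [sub_eq_zero] at h; exact hz (h ▸ hx)
    simp [h]

/-- An approximate eigenvector of a normal operator with error `ε` forces a spectral point at
distance at most `ε`. -/
theorem exists_mem_spectrum_dist_le {A : E →L[ℂ] E} (hA : IsStarNormal A) {z : ℂ} {ε : ℝ}
    {x : E} (hx : x ≠ 0) (h : ‖A x - z • x‖ ≤ ε * ‖x‖) : ∃ t ∈ spectrum ℂ A, dist t z ≤ ε := by
  have hxp : 0 < ‖x‖ := norm_pos_iff.2 hx
  have hε : 0 ≤ ε := by
    by_contra hn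
    push Not at hn
    nlinarith [norm_nonneg (A x - z • x)]
  have : Nontrivial E := ⟨x, 0, hx⟩
  obtain ⟨t, ht, htd⟩ := (spectrum.isCompact A).exists_infDist_eq_dist
    (spectrum.nonempty A) z
  refine ⟨t, ht, ?_⟩
  by_contra! hlt
  have hle : ∀ s ∈ spectrum ℂ A, dist t z ≤ dist s z := fun s hs => by
    rw [dist_comm t, ← htd, dist_comm s]; exact Metric.infDist_le_dist_of_mem hs
  have hd : 0 < dist t z := hε.trans_lt hlt
  have hz : z ∉ spectrum ℂ A := fun hz => by
    have := hle z hz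
    rw [dist_self] at this
    linarith
  have hc : ContinuousOn (fun x : ℂ => (x - z)⁻¹) (spectrum ℂ A) :=
    ContinuousOn.inv₀ (by fun_prop) fun s hs h0 => by
      rw [sub_eq_zero] at h0; exact hz (h0 ▸ hs)
  have h1 := (cfc_sub_mul_inv hA hc).2 hz
  have h2 : ‖cfc (fun x : ℂ => (x - z)⁻¹) A‖ ≤ (dist t z)⁻¹ := by
    refine norm_cfc_le (by positivity) fun s hs => ?_
    rw [norm_inv, ← dist_eq_norm]
    exact inv_anti₀ hd (hle s hs)
  have h3 : x = cfc (fun x : ℂ => (x - z)⁻¹) A (A x - z • x) := by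
    have := congrArg (fun B : E →L[ℂ] E => B x) h1
    simpa [Algebra.algebraMap_eq_smul_one] using this.symm
  have h4 := (cfc (fun x : ℂ => (x - z)⁻¹) A).le_opNorm (A x - z • x)
  rw [← h3] at h4
  have h5 : ‖x‖ ≤ (dist t z)⁻¹ * (ε * ‖x‖) := h4.trans (by gcongr)
  rw [inv_mul_eq_div, le_div_iff₀ hd] at h5
  nlinarith

/-- At an isolated point of the spectrum, a normal operator is bounded below on the orthogonal
complement of the eigenspace. -/
theorem exists_le_of_isolated {A : E →L[ℂ] E} (hA : IsStarNormal A) {z : ℂ}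
    (hz : ∃ ε > 0, ∀ z' ∈ spectrum ℂ A, dist z' z < ε → z' = z) :
    ∃ c > 0, ∀ x ∈ (Module.End.eigenspace (A : E →ₗ[ℂ] E) z)ᗮ, c * ‖x‖ ≤ ‖A x - z • x‖ := by
  obtain ⟨ε, hε, hiso⟩ := hz
  have hc : ContinuousOn (fun x : ℂ => (x - z)⁻¹) (spectrum ℂ A) := by
    intro s hs
    rcases eq_or_ne s z with rfl | hsz
    · have : spectrum ℂ A ∩ Metric.ball s ε ⊆ {s} := fun y hy => hiso y hy.1 hy.2
      refine ContinuousWithinAt.mono_of_mem_nhdsWithin (t := {s})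
        continuousWithinAt_singleton ?_
      exact mem_of_superset (inter_mem_nhdsWithin _ (Metric.ball_mem_nhds s hε)) this
    · have : ContinuousAt (fun x : ℂ => x - z) s := by fun_prop
      exact (this.inv₀ (sub_ne_zero.2 hsz)).continuousWithinAt
  set B := cfc (fun x : ℂ => (x - z)⁻¹) A
  have h1 := (cfc_sub_mul_inv hA hc).1
  refine ⟨(‖B‖ + 1)⁻¹, by positivity, fun x hx => ?_⟩
  set y := A x - z • x with hy
  -- `B` recovers x from `y` up to an eigenvector; as x is orthogonal to the eigenspace, ‖x‖² = ⟨B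
  -- y, x⟩ and so ‖x‖ ≤ ‖B y‖.
  have h2 : A (B y - x) - z • (B y - x) = 0 := by
    have := congrArg (fun C : E →L[ℂ] E => C x) h1
    simp only [Algebra.algebraMap_eq_smul_one, mul_apply_eq_comp,
      sub_apply, smul_apply,
      one_apply_eq_self] at this
    rw [map_sub, smul_sub, sub_sub_sub_comm, ← hy, sub_eq_zero]
    exact this
  have h3 : B y - x ∈ Module.End.eigenspace (A : E →ₗ[ℂ] E) z := by
    rw [Module.End.mem_eigenspace_iff]
    exact sub_eq_zero.1 h2
  have h4 : inner ℂ (B y - x) x = 0 := hx _ h3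
  have h5 : ‖x‖ ≤ ‖B y‖ := by
    have h6 : inner ℂ (B y) x = inner ℂ x x := by
      rw [inner_sub_left, sub_eq_zero] at h4; exact h4
    have h7 := norm_inner_le_norm (𝕜 := ℂ) (B y) x
    rw [h6, inner_self_eq_norm_sq_to_K] at h7
    simp only [norm_pow, Complex.coe_algebraMap, Complex.norm_real, norm_norm] at h7
    by_contra! hlt
    have : 0 < ‖x‖ := (norm_nonneg _).trans_lt hlt
    nlinarith
  have h6 := B.le_opNorm y
  rw [inv_mul_le_iff₀ (by positivity)]
  nlinarith [norm_nonneg y]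

/-- A compactness argument: for unit vectors in `K` with `T x → 0`, a subsequence makes `Q x`
converge in the finite-dimensional space. The estimate `hC` then makes the vectors Cauchy, and their
limit is a unit vector of `K` killed by `T`. -/
theorem exists_le_of_le_add_finiteDimensional {F G : Type*} [NormedAddCommGroup F]
    [InnerProductSpace ℂ F] [NormedAddCommGroup G] [NormedSpace ℂ G] [FiniteDimensional ℂ G]
    (T : E →L[ℂ] F) (Q : E →L[ℂ] G) {C : ℝ} (hC : ∀ x, ‖x‖ ≤ C * (‖T x‖ + ‖Q x‖))
    (K : Submodule ℂ E) (hK : IsClosed (K : Set E)) (hTK : ∀ x ∈ K, T x = 0 → x = 0) :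
    ∃ c > 0, ∀ x ∈ K, c * ‖x‖ ≤ ‖T x‖ := by
  by_contra! h
  have h1 : ∀ n : ℕ, ∃ x ∈ K, ‖x‖ = 1 ∧ ‖T x‖ < 1 / ((n : ℝ) + 1) := by
    intro n
    obtain ⟨x, hxK, hx⟩ := h (1 / ((n : ℝ) + 1)) (by positivity)
    have hx0 : 0 < ‖x‖ := by
      rw [norm_pos_iff]
      rintro rfl
      simp at hx
    refine ⟨((‖x‖⁻¹ : ℝ) : ℂ) • x, K.smul_mem _ hxK, ?_, ?_⟩
    · rw [norm_smul, Complex.norm_real, norm_inv, norm_norm, inv_mul_cancel₀ hx0.ne']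
    · rw [map_smul, norm_smul, Complex.norm_real, norm_inv, norm_norm, inv_mul_lt_iff₀ hx0,
        mul_comm]
      exact hx
  choose x hxK hx1 hxT using h1
  have hT0 : Tendsto (fun n => T (x n)) atTop (𝓝 0) := by
    rw [tendsto_zero_iff_norm_tendsto_zero]
    exact squeeze_zero (fun _ => norm_nonneg _) (fun n => (hxT n).le)
      tendsto_one_div_add_atTop_nhds_zero_nat
  have : ProperSpace G := FiniteDimensional.proper ℂ G
  have hQ : ∀ n, Q (x n) ∈ Metric.closedBall (0 : G) ‖Q‖ := fun n => by
    rw [mem_closedBall_zero_iff]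
    simpa [hx1 n] using Q.le_opNorm (x n)
  obtain ⟨g, -, φ, hφ, hg⟩ := (isCompact_closedBall (0 : G) ‖Q‖).tendsto_subseq hQ
  have hpair : CauchySeq fun n => (T (x (φ n)), Q (x (φ n))) :=
    ((hT0.comp hφ.tendsto_atTop).prodMk_nhds hg).cauchySeq
  have hcs : CauchySeq fun n => x (φ n) := by
    rw [Metric.cauchySeq_iff] at hpair ⊢
    intro ε hε
    obtain ⟨N, hN⟩ := hpair (ε / (2 * (|C| + 1))) (by positivity)
    refine ⟨N, fun m hm n hn => ?_⟩
    have h2 := hN m hm n hn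
    rw [Prod.dist_eq, max_lt_iff] at h2
    simp only [dist_eq_norm, ← map_sub] at h2 ⊢
    refine (hC _).trans_lt ?_
    calc C * (‖T (x (φ m) - x (φ n))‖ + ‖Q (x (φ m) - x (φ n))‖)
        ≤ (|C| + 1) * (‖T (x (φ m) - x (φ n))‖ + ‖Q (x (φ m) - x (φ n))‖) := by
          gcongr
          linarith [le_abs_self C]
      _ < (|C| + 1) * (ε / (2 * (|C| + 1)) + ε / (2 * (|C| + 1))) := by
          gcongr
          · exact h2.1
          · exact h2.2
      _ = ε := by field_simp; ring
  obtain ⟨y, hy⟩ := cauchySeq_tendsto_of_complete hcs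
  have hyK : y ∈ K := hK.mem_of_tendsto hy (Eventually.of_forall fun n => hxK _)
  have hyT : T y = 0 :=
    tendsto_nhds_unique ((T.continuous.tendsto y).comp hy) (hT0.comp hφ.tendsto_atTop)
  have hy1 : ‖y‖ = 1 := by
    refine tendsto_nhds_unique hy.norm ?_
    simp only [hx1]
    exact tendsto_const_nhds
  rw [hTK y hyK hyT, norm_zero] at hy1
  exact zero_ne_one hy1

/-- If `A - z` is bounded below up to a finite-dimensional term, then `z` does not belong to the
essential spectrum of the normal operator `A`. -/
theorem notMem_essentialSpectrum {G : Type*} [NormedAddCommGroup G] [NormedSpace ℂ G]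
    [FiniteDimensional ℂ G] {A : E →L[ℂ] E} (hA : IsStarNormal A) {z : ℂ} (Q : E →L[ℂ] G)
    {C : ℝ} (hC : ∀ x, ‖x‖ ≤ C * (‖A x - z • x‖ + ‖Q x‖)) : z ∉ essentialSpectrum A := by
  rintro ⟨hz, hnd⟩
  refine hnd ⟨hz, ?_⟩
  set T : E →L[ℂ] E := A - algebraMap ℂ _ z with hT
  have hTx : ∀ x, T x = A x - z • x := fun x => by simp [hT, Algebra.algebraMap_eq_smul_one]
  set N := Module.End.eigenspace (A : E →ₗ[ℂ] E) z with hN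
  have hmem : ∀ x, x ∈ N ↔ T x = 0 := fun x => by
    rw [hN, Module.End.mem_eigenspace_iff, hTx, sub_eq_zero]; rfl
  have hfin : FiniteDimensional ℂ N := by
    refine FiniteDimensional.of_injective ((Q : E →ₗ[ℂ] G).comp N.subtype) ?_
    rw [← LinearMap.ker_eq_bot, LinearMap.ker_eq_bot']
    intro x hx
    have h1 := hC x
    have h2 : Q x = 0 := hx
    rw [← hTx, (hmem x).1 x.2, h2, norm_zero, norm_zero, add_zero, mul_zero] at h1
    simpa using h1
  obtain ⟨c, hc, hcb⟩ := exists_le_of_le_add_finiteDimensional T Q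
    (fun x => by rw [hTx]; exact hC x) Nᗮ (Submodule.isClosed_orthogonal N) fun x hx h0 => by
      have h1 : inner ℂ x x = 0 := hx x ((hmem x).2 h0)
      exact inner_self_eq_zero.1 h1
  -- By normality the eigenspace is reducing, so `A - z'` splits orthogonally: it is the scalar z -
  -- z' on `N` and bounded below by c - |z' - z| on the complement.
  have horth : ∀ k ∈ N, ∀ p ∈ Nᗮ, inner ℂ k (T p) = 0 := by
    intro k hk p _
    have hadj : ContinuousLinearMap.adjoint T k = 0 := by
      have h1 := ContinuousLinearMap.isStarNormal_iff_norm_eq_adjoint.1 (hA.sub_algebraMap z) k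
      rw [← hT, (hmem k).1 hk, norm_zero] at h1
      exact norm_eq_zero.1 h1.symm
    rw [← ContinuousLinearMap.adjoint_inner_left, hadj, inner_zero_left]
  have key : ∀ z' : ℂ, ∀ x, min (dist z' z) (c - dist z' z) * ‖x‖ ≤ 2 * ‖A x - z' • x‖ ∨
      c ≤ dist z' z := by
    intro z' x
    rcases le_or_gt c (dist z' z) with h | h
    · exact Or.inr h
    left
    obtain ⟨k, hk, p, hp, rfl⟩ := N.exists_add_mem_mem_orthogonal x
    set m := min (dist z' z) (c - dist z' z) with hm
    have hm0 : 0 ≤ m := le_min dist_nonneg (by linarith)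
    have e1 : A (k + p) - z' • (k + p) = (z - z') • k + (T p + (z - z') • p) := by
      have h2 := (hmem k).1 hk
      rw [hTx] at h2
      rw [hTx, map_add, sub_eq_zero.1 h2]
      module
    have h3 : inner ℂ ((z - z') • k) (T p + (z - z') • p) = 0 := by
      rw [inner_smul_left, inner_add_right, horth k hk p hp, inner_smul_right, hp k hk]
      simp
    have hd : ‖z - z'‖ = dist z' z := by rw [dist_comm, dist_eq_norm]
    have h4 := norm_add_sq_eq_norm_sq_add_norm_sq_of_inner_eq_zero _ _ h3
    rw [← e1, norm_smul, hd] at h4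
    have h5 : m * ‖p‖ ≤ ‖T p + (z - z') • p‖ := by
      have h6 := norm_sub_le_norm_add (T p) ((z - z') • p)
      have h7 := hcb p hp
      have h8 : m ≤ c - dist z' z := min_le_right _ _
      rw [norm_smul, hd] at h6
      nlinarith [norm_nonneg p]
    have h9 : m * ‖k‖ ≤ dist z' z * ‖k‖ := by gcongr; exact min_le_left _ _
    have h10 : dist z' z * ‖k‖ ≤ ‖A (k + p) - z' • (k + p)‖ :=
      abs_le_of_sq_le_sq' (by nlinarith [sq_nonneg ‖T p + (z - z') • p‖]) (norm_nonneg _) |>.2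
    have h11 : ‖T p + (z - z') • p‖ ≤ ‖A (k + p) - z' • (k + p)‖ :=
      abs_le_of_sq_le_sq' (by nlinarith [sq_nonneg (dist z' z * ‖k‖)]) (norm_nonneg _) |>.2
    nlinarith [norm_add_le k p]
  refine ⟨⟨c, hc, fun z' hz' hd => ?_⟩, ?_, hfin⟩
  · by_contra hne
    have hpos : 0 < min (dist z' z) (c - dist z' z) :=
      lt_min (dist_pos.2 hne) (by linarith)
    obtain ⟨x, hx⟩ := exists_approx_eigenvector hA hz' (half_pos hpos)
    rcases key z' x with h | h <;> linarith
  · rw [Module.End.hasEigenvalue_iff]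
    intro hbot
    obtain ⟨x, hx⟩ := exists_approx_eigenvector hA hz hc
    have := hcb x (by rw [hN, hbot, Submodule.bot_orthogonal_eq_top]; trivial)
    rw [hTx] at this
    linarith

end NormalOperators

/-! ### Finitely supported vectors in ℓ² and Weyl's criterion. -/

section SquareSummable

variable {V : Type u} {W : Type w}

open Classical in
/-- The vector with value `f y` at `σ y` for `y ∈ K`. -/
noncomputable def lpPush (σ : W → V) (K : Finset W) (f : W → ℂ) : ℓ²(V, ℂ) :=
  ∑ y ∈ K, lp.single 2 (σ y) (f y)

theorem lpPush_apply {σ : W → V} {K : Finset W} (hσ : Set.InjOn σ K) (f : W → ℂ) {y : W}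
    (hy : y ∈ K) : lpPush σ K f (σ y) = f y := by
  classical
  simp only [lpPush, lp.coeFn_sum, Finset.sum_apply, lp.coeFn_single]
  rw [Finset.sum_eq_single y]
  · convert Pi.single_eq_same (M := fun _ : V => ℂ) (σ y) (f y)
  · intro w hw hne
    convert Pi.single_eq_of_ne (M := fun _ : V => ℂ) (i := σ w) (i' := σ y) ?_ (f w)
    exact fun h => hne (hσ hw hy h.symm)
  · exact fun h => absurd hy h

theorem lpPush_apply_of_notMem {σ : W → V} {K : Finset W} (f : W → ℂ) {v : V}
    (hv : ∀ y ∈ K, σ y ≠ v) : lpPush σ K f v = 0 := by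
  classical
  simp only [lpPush, lp.coeFn_sum, Finset.sum_apply, lp.coeFn_single]
  refine Finset.sum_eq_zero fun w hw => ?_
  convert Pi.single_eq_of_ne (M := fun _ : V => ℂ) (hv w hw).symm (f w)

theorem norm_sq_lp (ψ : ℓ²(V, ℂ)) {K : Finset V} (h : ∀ v ∉ K, ψ v = 0) :
    ‖ψ‖ ^ 2 = ∑ v ∈ K, ‖ψ v‖ ^ 2 := by
  have := lp.norm_rpow_eq_tsum (p := 2) (by simp) ψ
  simp only [ENNReal.toReal_ofNat, Real.rpow_ofNat] at this
  rw [this, tsum_eq_sum fun v hv => by simp [h v hv]]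

theorem sum_norm_sq_le_lp (ψ : ℓ²(V, ℂ)) (K : Finset V) : ∑ v ∈ K, ‖ψ v‖ ^ 2 ≤ ‖ψ‖ ^ 2 := by
  have := lp.sum_rpow_le_norm_rpow (p := 2) (by simp) ψ K
  simpa only [ENNReal.toReal_ofNat, Real.rpow_ofNat] using this

theorem norm_lpPush_sq {σ : W → V} {K : Finset W} (hσ : Set.InjOn σ K) (f : W → ℂ) :
    ‖lpPush σ K f‖ ^ 2 = ∑ y ∈ K, ‖f y‖ ^ 2 := by
  classical
  rw [norm_sq_lp (K := K.image σ) _ fun v hv => lpPush_apply_of_notMem f ?_,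
    Finset.sum_image hσ]
  · exact Finset.sum_congr rfl fun y hy => by rw [lpPush_apply hσ f hy]
  · rintro y hy rfl
    exact hv (Finset.mem_image_of_mem _ hy)

theorem norm_lpPush_le (σ : W → V) (K : Finset W) (f : W → ℂ) :
    ‖lpPush σ K f‖ ≤ ∑ y ∈ K, ‖f y‖ := by
  classical
  refine (norm_sum_le _ _).trans (Finset.sum_le_sum fun y _ => ?_)
  rw [lp.norm_single (by simp)]

theorem tendsto_lpPush (ψ : ℓ²(V, ℂ)) : Tendsto (fun K => lpPush id K ψ) atTop (𝓝 ψ) := by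
  classical
  have h := lp.hasSum_single (p := 2) (by simp) ψ
  rw [HasSum, SummationFilter.unconditional_filter] at h
  exact h

theorem lpPush_id_apply (K : Finset V) (f : V → ℂ) [DecidablePred (· ∈ K)] (v : V) :
    lpPush id K f v = if v ∈ K then f v else 0 := by
  split_ifs with h
  · exact lpPush_apply (σ := id) (Function.injective_id.injOn) f h
  · exact lpPush_apply_of_notMem (σ := id) f fun y hy => by rintro rfl; exact h hy

/-- Weyl's criterion on `ℓ²(V)`: the essential spectrum consists of the approximate eigenvalues
with finitely supported approximate eigenvectors avoiding any given finite set. -/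
theorem mem_essentialSpectrum_iff {A : ℓ²(V, ℂ) →L[ℂ] ℓ²(V, ℂ)} (hA : IsStarNormal A) {z : ℂ} :
    z ∈ essentialSpectrum A ↔ ∀ ε > 0, ∀ F : Finset V, ∃ K : Finset V, Disjoint K F ∧
      ∃ ψ : ℓ²(V, ℂ), ψ ≠ 0 ∧ (∀ v ∉ K, ψ v = 0) ∧ ‖A ψ - z • ψ‖ ≤ ε * ‖ψ‖ := by
  classical
  constructor
  · intro hz ε hε F
    by_contra! hcon
    set T : ℓ²(V, ℂ) →L[ℂ] ℓ²(V, ℂ) := A - algebraMap ℂ _ z with hT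
    have hTx : ∀ x, T x = A x - z • x := fun x => by simp [hT, Algebra.algebraMap_eq_smul_one]
    -- The failure of the criterion is a lower bound for finitely supported vectors; it passes to
    -- all vectors vanishing on `F` by approximation.
    have hbd : ∀ x : ℓ²(V, ℂ), (∀ v ∈ F, x v = 0) → ε * ‖x‖ ≤ ‖T x‖ := by
      intro x hx
      have hK : ∀ K, ε * ‖lpPush id K x‖ ≤ ‖T (lpPush id K x)‖ := by
        intro K
        by_cases h0 : lpPush id K x = 0
        · simp [h0]
        rw [hTx]
        refine (hcon (K \ F) Finset.sdiff_disjoint _ h0 fun v hv => ?_).le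
        rw [lpPush_id_apply]
        split_ifs with hvK
        · rw [Finset.mem_sdiff] at hv
          exact hx v (by tauto)
        · rfl
      exact le_of_tendsto_of_tendsto' ((tendsto_lpPush x).norm.const_mul ε)
        (((T.continuous.tendsto x).comp (tendsto_lpPush x)).norm) hK
    let Q : ℓ²(V, ℂ) →L[ℂ] (F → ℂ) :=
      ContinuousLinearMap.pi fun i => lp.evalCLM ℂ (fun _ : V => ℂ) 2 i
    have hQ : ∀ x (i : F), Q x i = x i := fun x i => rfl
    -- The finite-rank correction is restriction to `F`: the constant comes from splitting x into
    -- its part on `F` and the rest, to which `hbd` applies.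
    refine notMem_essentialSpectrum hA Q
      (C := (F.card : ℝ) + ε⁻¹ * (1 + ‖T‖ * F.card)) (fun x => ?_) hz
    rw [← hTx]
    set q := ‖Q x‖
    have h1 : ‖lpPush id F x‖ ≤ F.card * q := by
      refine (norm_lpPush_le _ _ _).trans ?_
      rw [← nsmul_eq_mul]
      refine Finset.sum_le_card_nsmul _ _ _ fun y hy => ?_
      exact norm_le_pi_norm (Q x) ⟨y, hy⟩
    have h2 := hbd (x - lpPush id F x) fun v hv => by
      rw [lp.coeFn_sub, Pi.sub_apply, lpPush_id_apply, if_pos hv, sub_self]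
    have h3 : ‖T (x - lpPush id F x)‖ ≤ ‖T x‖ + ‖T‖ * (F.card * q) := by
      rw [map_sub]
      refine (norm_sub_le _ _).trans ?_
      gcongr
      exact (T.le_opNorm _).trans (by gcongr)
    have h4 : ‖x - lpPush id F x‖ ≤ ε⁻¹ * (‖T x‖ + ‖T‖ * (F.card * q)) := by
      rw [inv_mul_eq_div, le_div_iff₀ hε, mul_comm]
      exact h2.trans h3
    have h5 : ‖x‖ ≤ ‖x - lpPush id F x‖ + ‖lpPush id F x‖ := by
      simpa using norm_add_le (x - lpPush id F x) (lpPush id F x)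
    have h6 : 0 ≤ ‖T x‖ := norm_nonneg _
    have h7 : 0 ≤ q := norm_nonneg _
    have h8 : 0 ≤ ε⁻¹ * (‖T‖ * F.card) * ‖T x‖ := by positivity
    have h9 : 0 ≤ (F.card : ℝ) * ‖T x‖ := by positivity
    have h10 : 0 ≤ ε⁻¹ * q := by positivity
    nlinarith
  · intro h
    refine ⟨mem_spectrum_of_approx fun ε hε => ?_, ?_⟩
    · obtain ⟨K, -, ψ, hψ, -, h1⟩ := h ε hε ∅
      exact ⟨ψ, hψ, h1⟩
    rintro ⟨-, hiso, -, hfin⟩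
    obtain ⟨c, hc, hcb⟩ := exists_le_of_isolated hA hiso
    set N := Module.End.eigenspace (A : ℓ²(V, ℂ) →ₗ[ℂ] ℓ²(V, ℂ)) z with hN
    let e := stdOrthonormalBasis ℂ N
    set n := Module.finrank ℂ N
    -- The basis vectors of the eigenspace are concentrated on a finite set `F` up to this error, so
    -- a vector avoiding `F` has a projection `p` onto the eigenspace of norm at most ‖ψ‖ / 2. Then
    -- ‖ψ - p‖ ≥ ‖ψ‖ / 2, and an error of c / 4 contradicts the lower bound c.
    have hδ : (0 : ℝ) < 1 / (2 * (n + 1)) := by positivity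
    have h1 : ∀ᶠ K in (atTop : Filter (Finset V)), ∀ i,
        ‖lpPush id K (e i : ℓ²(V, ℂ)) - e i‖ < 1 / (2 * (n + 1)) := by
      rw [eventually_all]
      intro i
      have := tendsto_lpPush (e i : ℓ²(V, ℂ))
      rw [tendsto_iff_norm_sub_tendsto_zero] at this
      exact this.eventually_lt_const hδ
    obtain ⟨F, hF⟩ := h1.exists
    obtain ⟨K, hKF, ψ, hψ, hψK, hψε⟩ := h (c / 4) (by positivity) F
    have hψF : ∀ v ∈ F, ψ v = 0 := fun v hv =>
      hψK v fun hvK => Finset.disjoint_left.1 hKF hvK hv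
    have hψp : 0 < ‖ψ‖ := norm_pos_iff.2 hψ
    have h2 : ∀ i, ‖inner ℂ (e i : ℓ²(V, ℂ)) ψ‖ ≤ 1 / (2 * (n + 1)) * ‖ψ‖ := by
      intro i
      have h3 : inner ℂ (lpPush id F (e i : ℓ²(V, ℂ))) ψ = 0 := by
        rw [lp.inner_eq_tsum]
        convert tsum_zero with v
        by_cases hv : v ∈ F
        · rw [hψF v hv, inner_zero_right]
        · rw [lpPush_id_apply, if_neg hv, inner_zero_left]
      have h4 : inner ℂ (e i : ℓ²(V, ℂ)) ψ =
          - inner ℂ (lpPush id F (e i : ℓ²(V, ℂ)) - e i) ψ := by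
        rw [inner_sub_left, h3, zero_sub, neg_neg]
      rw [h4, norm_neg]
      exact (norm_inner_le_norm _ _).trans (by gcongr; exact (hF i).le)
    set p : ℓ²(V, ℂ) := ∑ i, inner ℂ (e i : ℓ²(V, ℂ)) ψ • (e i : ℓ²(V, ℂ)) with hp
    have hpN : p ∈ N := N.sum_mem fun i _ => N.smul_mem _ (e i).2
    have hpn : ‖p‖ ≤ ‖ψ‖ / 2 := by
      calc ‖p‖ ≤ ∑ i : Fin n, ‖inner ℂ (e i : ℓ²(V, ℂ)) ψ • (e i : ℓ²(V, ℂ))‖ := norm_sum_le _ _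
        _ ≤ ∑ i : Fin n, 1 / (2 * ((n : ℝ) + 1)) * ‖ψ‖ := by
            refine Finset.sum_le_sum fun i _ => ?_
            have : ‖(e i : ℓ²(V, ℂ))‖ = 1 := e.orthonormal.1 i
            rw [norm_smul, this, mul_one]
            exact h2 i
        _ = (n / (n + 1)) * (‖ψ‖ / 2) := by
            rw [Finset.sum_const, Finset.card_univ, Fintype.card_fin, nsmul_eq_mul]
            field_simp
        _ ≤ 1 * (‖ψ‖ / 2) := by
            gcongr
            rw [div_le_one (by positivity)]
            linarith
        _ = ‖ψ‖ / 2 := one_mul _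
    have horth : ψ - p ∈ Nᗮ := by
      have h3 : p = N.starProjection ψ := by
        rw [Submodule.starProjection_apply, e.orthogonalProjectionOnto_apply_eq_sum]
        simp [hp]
      rw [h3]
      exact N.sub_starProjection_mem_orthogonal ψ
    have h4 := hcb _ horth
    have h5 : A p = z • p := Module.End.mem_eigenspace_iff.1 hpN
    have h6 : A (ψ - p) - z • (ψ - p) = A ψ - z • ψ := by
      rw [map_sub, h5]; module
    rw [h6] at h4
    have h7 := norm_sub_norm_le ψ p
    nlinarith

end SquareSummable

/-! ### Matrix entries, self-adjointness and transport of vectors between graphs. -/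

namespace JacobiMatrix

variable {V : Type u} {G : SimpleGraph V} {V' : Type w} {G' : SimpleGraph V'}

/-- Expresses the action through matrix entries, which are the data controlled by R-limits. -/
theorem act_eq_sum_entry [G.LocallyFinite] (J : JacobiMatrix G) (ψ : V → ℂ) {S : Finset V}
    (hS : ∀ v ∉ S, ψ v = 0) (x : V) : J.act ψ x = ∑ u ∈ S, (J.entry u x : ℂ) * ψ u := by
  classical
  have h1 : ∀ u ∈ S, (J.entry u x : ℂ) * ψ u =
      (if u = x then (J.b x : ℂ) * ψ x else 0) +
        if u ∈ G.neighborFinset x then (J.a u x : ℂ) * ψ u else 0 := by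
    intro u _
    simp only [entry, SimpleGraph.mem_neighborFinset]
    by_cases h : u = x
    · subst h; simp
    · by_cases h' : G.Adj u x
      · simp [h, h', h'.symm]
      · have h'' : ¬ G.Adj x u := fun h'' => h' h''.symm
        simp [h, h', h'']
  rw [Finset.sum_congr rfl h1, Finset.sum_add_distrib, Finset.sum_ite_eq', act, add_comm]
  congr 1
  · split_ifs with h
    · rfl
    · rw [hS x h, mul_zero]
  · rw [← Finset.sum_filter]
    symm
    refine Finset.sum_subset_zero_on_sdiff (fun u hu => (Finset.mem_filter.1 hu).2) ?_
      fun _ _ => rfl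
    intro u hu
    rw [Finset.mem_sdiff, Finset.mem_filter] at hu
    rw [hS u (by tauto), mul_zero]

theorem op_isSelfAdjoint [G.LocallyFinite] (J : JacobiMatrix G) (hG : HasBoundedDegree G) :
    IsSelfAdjoint (J.op hG) := by
  classical
  rw [ContinuousLinearMap.isSelfAdjoint_iff']
  ext ψ v
  have h1 : J.op hG (lp.single 2 v 1) =
      ∑ u ∈ G.neighborFinset v, (J.a u v : ℂ) • lp.single 2 u (1 : ℂ) +
        (J.b v : ℂ) • lp.single 2 v (1 : ℂ) := by
    ext x
    simp only [op_apply, lp.coeFn_single, lp.coeFn_add, lp.coeFn_sum, lp.coeFn_smul, Pi.add_apply,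
      Finset.sum_apply, Pi.smul_apply, Pi.single_apply, smul_eq_mul, mul_ite, mul_one, mul_zero]
    rw [Finset.sum_ite_eq', Finset.sum_ite_eq]
    simp only [SimpleGraph.mem_neighborFinset]
    congr 1
    · by_cases h : G.Adj x v
      · rw [if_pos h, if_pos h.symm, J.a_symm _ _ h]
      · rw [if_neg h, if_neg fun h' => h h'.symm]
    · by_cases h : x = v
      · subst h; simp
      · simp [h]
  have h2 : (ContinuousLinearMap.adjoint (J.op hG) ψ) v =
      inner ℂ (lp.single 2 v (1 : ℂ)) (ContinuousLinearMap.adjoint (J.op hG) ψ) := by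
    rw [lp.inner_single_left]; simp
  rw [h2, ContinuousLinearMap.adjoint_inner_right, h1, inner_add_left, sum_inner,
    inner_smul_left, lp.inner_single_left, op_apply]
  congr 1
  · refine Finset.sum_congr rfl fun u _ => ?_
    rw [inner_smul_left, lp.inner_single_left]
    simp
  · simp

/-- Approximate eigenvectors can be transported along a bijection between finite sets of vertices
which almost preserves the matrix entries. -/
theorem exists_transport [G.LocallyFinite] [G'.LocallyFinite] (J : JacobiMatrix G)
    (J' : JacobiMatrix G') (hG : HasBoundedDegree G) (hG' : HasBoundedDegree G')
    {σ : V' → V} {K S : Finset V'} (hσ : Set.InjOn σ K) (hSK : S ⊆ K)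
    (hadj : ∀ y ∈ S, ∀ x, G.Adj (σ y) x → ∃ y' ∈ K, σ y' = x)
    {φ : ℓ²(V', ℂ)} (hφ : ∀ v ∉ S, φ v = 0) {δ : ℝ} (hδ : 0 ≤ δ)
    (hent : ∀ x ∈ K, ∀ y ∈ K, |J.entry (σ x) (σ y) - J'.entry x y| ≤ δ) (z : ℂ) :
    ∃ ψ : ℓ²(V, ℂ), (∀ v, (∀ y ∈ S, σ y ≠ v) → ψ v = 0) ∧ ‖ψ‖ = ‖φ‖ ∧
      ‖J.op hG ψ - z • ψ‖ ≤ ‖J'.op hG' φ - z • φ‖ + K.card ^ 2 * δ * ‖φ‖ := by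
  classical
  have hσS : Set.InjOn σ S := hσ.mono (by exact_mod_cast hSK)
  set ψ := lpPush σ S φ with hψ
  have hψ0 : ∀ v, (∀ y ∈ S, σ y ≠ v) → ψ v = 0 := fun v hv => lpPush_apply_of_notMem _ hv
  have hψσ : ∀ y ∈ K, ψ (σ y) = φ y := by
    intro y hy
    by_cases hyS : y ∈ S
    · exact lpPush_apply hσS _ hyS
    · rw [hφ y hyS, hψ0]
      exact fun w hw h => hyS (hσ (hSK hw) hy h ▸ hw)
  have hnorm : ‖ψ‖ = ‖φ‖ := by
    rw [← sq_eq_sq₀ (norm_nonneg _) (norm_nonneg _), hψ, norm_lpPush_sq hσS, norm_sq_lp φ hφ]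
  refine ⟨ψ, hψ0, hnorm, ?_⟩
  have hact : ∀ x, J.op hG ψ x = ∑ u ∈ S, (J.entry (σ u) x : ℂ) * φ u := by
    intro x
    change J.act ψ x = _
    rw [J.act_eq_sum_entry ψ (S := S.image σ) (fun v hv => hψ0 v fun y hy h =>
      hv (h ▸ Finset.mem_image_of_mem _ hy)), Finset.sum_image hσS]
    exact Finset.sum_congr rfl fun u hu => by rw [hψσ u (hSK hu)]
  have hact' : ∀ x, J'.op hG' φ x = ∑ u ∈ S, (J'.entry u x : ℂ) * φ u :=
    fun x => J'.act_eq_sum_entry φ hφ x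
  set η := J.op hG ψ - z • ψ with hη
  set θ := J'.op hG' φ - z • φ with hθ
  -- By `hadj` the vector `η` vanishes off the image of `K`. There it is the copy of `θ` plus a
  -- discrepancy at no more than |K| sites, each a sum of at most |K| terms bounded by δ‖φ‖.
  have hdecomp : η = lpPush σ K θ + lpPush σ K (fun y => η (σ y) - θ y) := by
    ext x
    rw [lp.coeFn_add, Pi.add_apply]
    by_cases hx : ∃ y ∈ K, σ y = x
    · obtain ⟨y, hy, rfl⟩ := hx
      rw [lpPush_apply hσ _ hy, lpPush_apply hσ _ hy]
      ring
    · push Not at hx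
      rw [lpPush_apply_of_notMem _ hx, lpPush_apply_of_notMem _ hx, hη, lp.coeFn_sub,
        lp.coeFn_smul, Pi.sub_apply, Pi.smul_apply, hψ0 x (fun y hy => hx y (hSK hy)), hact,
        smul_zero, sub_zero, add_zero]
      refine Finset.sum_eq_zero fun u hu => ?_
      have h1 : σ u ≠ x := hx u (hSK hu)
      have h2 : ¬ G.Adj (σ u) x := fun h => by
        obtain ⟨y', hy', h'⟩ := hadj u hu x h
        exact hx y' hy' h'
      simp [entry, h1, h2]
  have h1 : ‖lpPush σ K θ‖ ≤ ‖θ‖ := by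
    refine abs_le_of_sq_le_sq' ?_ (norm_nonneg _) |>.2
    rw [norm_lpPush_sq hσ]
    exact sum_norm_sq_le_lp θ K
  have h2 : ∀ y ∈ K, ‖η (σ y) - θ y‖ ≤ K.card * (δ * ‖φ‖) := by
    intro y hy
    have h3 : η (σ y) - θ y = ∑ u ∈ S, ((J.entry (σ u) (σ y) - J'.entry u y : ℝ) : ℂ) * φ u := by
      simp only [hη, hθ, lp.coeFn_sub, lp.coeFn_smul, Pi.sub_apply, Pi.smul_apply, hψσ y hy]
      rw [sub_sub_sub_cancel_right, hact, hact', ← Finset.sum_sub_distrib]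
      refine Finset.sum_congr rfl fun u _ => ?_
      push_cast
      ring
    rw [h3]
    calc _ ≤ ∑ u ∈ S, ‖((J.entry (σ u) (σ y) - J'.entry u y : ℝ) : ℂ) * φ u‖ := norm_sum_le _ _
      _ ≤ ∑ u ∈ S, δ * ‖φ‖ := by
        refine Finset.sum_le_sum fun u hu => ?_
        rw [norm_mul, Complex.norm_real]
        exact mul_le_mul (hent u (hSK hu) y hy) (lp.norm_apply_le_norm (by simp) φ u)
          (norm_nonneg _) hδ
      _ = S.card * (δ * ‖φ‖) := by rw [Finset.sum_const, nsmul_eq_mul]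
      _ ≤ _ := by gcongr
  rw [hdecomp]
  refine (norm_add_le _ _).trans (add_le_add h1 ((norm_lpPush_le _ _ _).trans ?_))
  refine (Finset.sum_le_card_nsmul _ _ _ h2).trans (le_of_eq ?_)
  rw [nsmul_eq_mul]
  ring

end JacobiMatrix

/-- By coherence the smaller ball occupies an initial segment of the enumeration of the larger one.
Hence matching indices automatically matches the inner balls as soon as their cardinalities agree.
-/
theorem CoherentEnumeration.mem_graphBall_iff {V : Type u} {G : SimpleGraph V} {v : V}
    (e : CoherentEnumeration G v) {r s : ℕ} (hr : 1 ≤ r) (hrs : r < s) {x : V}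
    (hx : x ∈ graphBall G v s) :
    x ∈ graphBall G v r ↔ (e.η s ⟨x, hx⟩ : ℕ) < ballCard G v r := by
  constructor
  · intro h
    rw [e.coherent r s hr hrs x h hx]
    exact Fin.is_lt _
  · intro h
    set y := (e.η r).symm ⟨_, h⟩ with hy
    have hys : (y : V) ∈ graphBall G v s := le_trans y.2 hrs.le
    have h1 := e.coherent r s hr hrs y y.2 hys
    have h2 : e.η r ⟨y, y.2⟩ = ⟨_, h⟩ := by rw [hy]; exact Equiv.apply_symm_apply _ _
    rw [h2] at h1
    have h3 : (⟨y, hys⟩ : graphBall G v s) = ⟨x, hx⟩ := (e.η s).injective (Fin.ext h1)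
    exact (show (y : V) = x from congrArg Subtype.val h3) ▸ y.2

theorem CoherentEnumeration.finite_graphBall {V : Type u} {G : SimpleGraph V} {v : V}
    (e : CoherentEnumeration G v) (r : ℕ) : (graphBall G v r).Finite :=
  Set.finite_coe_iff.1 (Finite.of_equiv _ (e.η r).symm)

/-! ### Spectra of R-limits lie in the essential spectrum. -/

namespace JacobiMatrix

variable {V : Type u} {G : SimpleGraph V}

theorem closure_rLimitSpectra_subset [G.LocallyFinite] (hconn : G.Connected) (J : JacobiMatrix G)
    (hG : HasBoundedDegree G) : closure J.rLimitSpectra ⊆ essentialSpectrum (J.op hG) := by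
  classical
  intro z hz
  rw [mem_essentialSpectrum_iff (J.op_isSelfAdjoint hG).isStarNormal]
  intro ε hε A
  obtain ⟨z', ⟨W, F, hLF, hF, L, w₀, hFc, ⟨v, ⟨o, hv⟩, n, hn, e, e', hconv⟩, hz'⟩, hzz⟩ :=
    Metric.mem_closure_iff.1 hz (ε / 4) (by positivity)
  obtain ⟨x, hx⟩ := exists_approx_eigenvector (L.op_isSelfAdjoint hF).isStarNormal hz'
    (show 0 < ε / 4 by positivity)
  obtain ⟨S, hS⟩ : ∃ S, ‖L.op hF (lpPush id S x) - z' • lpPush id S x‖ <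
      ε / 4 * ‖lpPush id S x‖ := by
    have h1 := tendsto_lpPush x
    have h2 := ((((L.op hF).continuous.tendsto x).comp h1).sub (h1.const_smul z')).norm
    exact (h2.eventually_lt (h1.norm.const_mul (ε / 4)) hx).exists
  set φ := lpPush id S x with hφ
  have hφS : ∀ v ∉ S, φ v = 0 := fun v hv => by rw [hφ, lpPush_id_apply, if_neg hv]
  have hφ0 : φ ≠ 0 := by
    intro h; simp [h] at hS
  -- The added 1 keeps r ≥ 1, since coherence says nothing about radius 0. The matrices are compared
  -- on radius r + 1, so that neighbours of the support are covered.
  set r := (S.sup fun y => F.dist y w₀) + 1 with hr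
  have hSr : ∀ y ∈ S, y ∈ graphBall F w₀ r := fun y hy => by
    have := Finset.le_sup (f := fun y => F.dist y w₀) hy
    simp only [graphBall, Set.mem_ofPred_eq]
    omega
  set K := (e'.finite_graphBall (r + 1)).toFinset with hK
  have hKm : ∀ y, y ∈ K ↔ y ∈ graphBall F w₀ (r + 1) := fun y => by rw [hK]; simp
  have hSK : S ⊆ K := fun y hy => (hKm y).2 (le_trans (hSr y hy) (Nat.le_succ r))
  set δ := ε / (4 * (K.card ^ 2 + 1)) with hδ
  have hδ0 : 0 < δ := by positivity
  -- A centre further than m from `o` has a ball of radius r disjoint from `A`.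
  set m := r + A.sup fun a => G.dist a o with hm
  have hfar : ∀ᶠ j in atTop, m + 1 ≤ G.dist (v (n j)) o :=
    (hv.comp hn.tendsto_atTop).eventually_ge_atTop _
  obtain ⟨j, ⟨⟨hcard, hent⟩, ⟨hcard', -⟩⟩, hj⟩ :=
    (((hconv (r + 1) (by omega) δ hδ0).and (hconv r (by omega) 1 one_pos)).and hfar).exists
  set ι : graphBall F w₀ (r + 1) ≃ graphBall G (v (n j)) (r + 1) :=
    (e'.η (r + 1)).trans ((finCongr hcard).trans ((e j).η (r + 1)).symm) with hι
  have hιη : ∀ y, ((e j).η (r + 1) (ι y) : ℕ) = e'.η (r + 1) y := fun y => by simp [hι]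
  -- The value off the ball is irrelevant: `σ` is only used on `K`.
  set σ : W → V := fun y => if h : y ∈ graphBall F w₀ (r + 1) then ι ⟨y, h⟩ else v (n j) with hσ
  have hσι : ∀ y (h : y ∈ graphBall F w₀ (r + 1)), σ y = ι ⟨y, h⟩ := fun y h => by
    simp only [hσ, dif_pos h]
  have hinj : Set.InjOn σ K := by
    intro y hy y' hy' h
    rw [Finset.mem_coe, hKm] at hy hy'
    rw [hσι y hy, hσι y' hy'] at h
    exact congrArg Subtype.val (ι.injective (Subtype.ext h))
  have hσr : ∀ y ∈ S, σ y ∈ graphBall G (v (n j)) r := by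
    intro y hy
    have h1 := (hKm y).1 (hSK hy)
    rw [hσι y h1, (e j).mem_graphBall_iff (by omega) (Nat.lt_succ_self r) (ι ⟨y, h1⟩).2]
    have h2 := hιη ⟨y, h1⟩
    refine (lt_of_eq_of_lt h2 ?_)
    rw [← hcard']
    exact (e'.mem_graphBall_iff (by omega) (Nat.lt_succ_self r) h1).1 (hSr y hy)
  obtain ⟨ψ, hψ0, hψn, hψ⟩ := J.exists_transport L hG hF (K := K) (S := S) hinj hSK (φ := φ)
    (δ := δ) (fun y hy x hadj => by
      have h1 : x ∈ graphBall G (v (n j)) (r + 1) := by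
        have h2 := hσr y hy
        have h3 := hconn.dist_triangle (u := x) (v := σ y) (w := v (n j))
        have h4 : G.dist x (σ y) = 1 := SimpleGraph.dist_eq_one_iff_adj.2 hadj.symm
        simp only [graphBall, Set.mem_ofPred_eq] at h2 ⊢
        omega
      refine ⟨ι.symm ⟨x, h1⟩, (hKm _).2 (ι.symm ⟨x, h1⟩).2, ?_⟩
      rw [hσι _ (ι.symm ⟨x, h1⟩).2]
      simp) hφS hδ0.le (fun x hx y hy => by
      rw [hKm] at hx hy
      have := hent (e'.η (r + 1) ⟨x, hx⟩) (e'.η (r + 1) ⟨y, hy⟩)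
      simp only [ballMatrix, Matrix.of_apply, Equiv.symm_apply_apply] at this
      rw [hσι x hx, hσι y hy]
      exact this.le) z'
  refine ⟨S.image σ, ?_, ψ, ?_, fun v hv => hψ0 v fun y hy h => hv ?_, ?_⟩
  · rw [Finset.disjoint_left]
    intro a ha haA
    obtain ⟨y, hy, rfl⟩ := Finset.mem_image.1 ha
    have h1 := hσr y hy
    have h2 := Finset.le_sup (f := fun a => G.dist a o) haA
    have h3 := hconn.dist_triangle (u := v (n j)) (v := σ y) (w := o)
    rw [SimpleGraph.dist_comm (u := v (n j)) (v := σ y)] at h3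
    simp only [graphBall, Set.mem_ofPred_eq] at h1 h2
    omega
  · rw [← norm_ne_zero_iff, hψn]
    exact norm_ne_zero_iff.2 hφ0
  · exact h ▸ Finset.mem_image_of_mem σ hy
  -- Three errors of at most ε / 4 each: moving z to z', the approximate eigenvector of `L`, and the
  -- transport.
  · have h1 : J.op hG ψ - z • ψ = (J.op hG ψ - z' • ψ) - (z - z') • ψ := by module
    have h2 : ‖(z - z') • ψ‖ ≤ ε / 4 * ‖φ‖ := by
      rw [norm_smul, hψn, ← dist_eq_norm]
      gcongr
    have h3 : (K.card : ℝ) ^ 2 * δ ≤ ε / 4 := by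
      rw [hδ, ← mul_div_assoc, div_le_div_iff₀ (by positivity) (by norm_num)]
      nlinarith
    rw [h1, hψn]
    refine (norm_sub_le _ _).trans ?_
    nlinarith [norm_nonneg φ]

end JacobiMatrix

/-! ### Ancestor cutoffs and localization of approximate eigenvectors. -/

section Ancestors

variable {V : Type u}

open Classical in
/-- The first `R` iterates of `x` under the map `p`. -/
noncomputable def iterateFinset (p : V → V) (R : ℕ) (x : V) : Finset V :=
  (Finset.range R).image fun k => p^[k] x

theorem mem_iterateFinset {p : V → V} {R : ℕ} {x w : V} :
    w ∈ iterateFinset p R x ↔ ∃ k < R, p^[k] x = w := by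
  simp only [iterateFinset, Finset.mem_image, Finset.mem_range]

theorem card_iterateFinset_le (p : V → V) (R : ℕ) (x : V) : (iterateFinset p R x).card ≤ R := by
  classical
  exact Finset.card_image_le.trans (Finset.card_range R).le

open Classical in
/-- The indicator function of `iterateFinset p R x`. -/
noncomputable def iterateIndicator (p : V → V) (R : ℕ) (w x : V) : ℝ :=
  if w ∈ iterateFinset p R x then 1 else 0

theorem sum_iterateIndicator_le (p : V → V) (R : ℕ) (x : V) (Z : Finset V) :
    ∑ w ∈ Z, iterateIndicator p R w x ≤ R := by
  classical
  simp only [iterateIndicator, Finset.sum_boole]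
  refine (Nat.cast_le.2 ((Finset.card_le_card ?_).trans (card_iterateFinset_le p R x)))
  exact fun w hw => (Finset.mem_filter.1 hw).2

theorem sum_iterateIndicator_eq (p : V → V) (R : ℕ) (x : V) {Z : Finset V}
    (hZ : iterateFinset p R x ⊆ Z) :
    ∑ w ∈ Z, iterateIndicator p R w x = (iterateFinset p R x).card := by
  classical
  simp only [iterateIndicator, Finset.sum_boole]
  congr 2
  ext w
  simp only [Finset.mem_filter]
  exact ⟨fun h => h.2, fun h => ⟨hZ h, h⟩⟩

/-- Passing from x to `p x` shifts the list of the first R iterates by one, so the two sets can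
differ only in x and `p^[R] x`. The independence of R is what makes the localization work. -/
theorem sum_iterateIndicator_sub_sq_le_of_eq (p : V → V) (R : ℕ) (x : V) (Z : Finset V) :
    ∑ w ∈ Z, (iterateIndicator p R w (p x) - iterateIndicator p R w x) ^ 2 ≤ 2 := by
  classical
  have h1 : ∀ w ∈ Z, (iterateIndicator p R w (p x) - iterateIndicator p R w x) ^ 2 ≤
      (if w = x then 1 else 0) + if w = p^[R] x then 1 else 0 := by
    intro w _
    by_cases hx : w = x
    · rw [if_pos hx]
      have : (0 : ℝ) ≤ if w = p^[R] x then 1 else 0 := by split_ifs <;> norm_num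
      have : (iterateIndicator p R w (p x) - iterateIndicator p R w x) ^ 2 ≤ 1 := by
        unfold iterateIndicator
        split_ifs <;> norm_num
      linarith
    by_cases hR : w = p^[R] x
    · rw [if_pos hR, if_neg hx]
      unfold iterateIndicator
      split_ifs <;> norm_num
    have h2 : w ∈ iterateFinset p R (p x) ↔ w ∈ iterateFinset p R x := by
      rw [mem_iterateFinset, mem_iterateFinset]
      constructor
      · rintro ⟨k, hk, rfl⟩
        refine ⟨k + 1, ?_, rfl⟩
        rcases Nat.lt_or_ge (k + 1) R with h | h
        · exact h
        · have : R = k + 1 := by omega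
          exact absurd (by rw [this]; rfl) hR
      · rintro ⟨k, hk, rfl⟩
        rcases k with _ | k
        · exact absurd rfl hx
        · exact ⟨k, by omega, rfl⟩
    simp [iterateIndicator, h2, hx, hR]
  refine (Finset.sum_le_sum h1).trans ?_
  rw [Finset.sum_add_distrib, Finset.sum_ite_eq', Finset.sum_ite_eq']
  split_ifs <;> norm_num

theorem sum_iterateIndicator_sub_sq_le {p : V → V} {x y : V} (h : p x = y ∨ p y = x) (R : ℕ)
    (Z : Finset V) :
    ∑ w ∈ Z, (iterateIndicator p R w y - iterateIndicator p R w x) ^ 2 ≤ 2 := by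
  rcases h with rfl | rfl
  · exact sum_iterateIndicator_sub_sq_le_of_eq p R x Z
  · simp_rw [sub_sq_comm (iterateIndicator p R _ y)]
    exact sum_iterateIndicator_sub_sq_le_of_eq p R y Z

end Ancestors

theorem SimpleGraph.sum_sum_neighborFinset_le {V : Type u} {G : SimpleGraph V} [G.LocallyFinite]
    {D : ℕ} (hD : ∀ v, G.degree v ≤ D) (ψ : ℓ²(V, ℂ)) (X : Finset V) :
    ∑ x ∈ X, ∑ u ∈ G.neighborFinset x, ‖ψ u‖ ^ 2 ≤ D * ‖ψ‖ ^ 2 := by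
  classical
  have hcomm : ∑ v ∈ X, ∑ u ∈ G.neighborFinset v, ‖ψ u‖ ^ 2 =
      ∑ u ∈ X.biUnion (fun v => G.neighborFinset v), ∑ v ∈ X with G.Adj u v, ‖ψ u‖ ^ 2 := by
    apply Finset.sum_comm'
    intro x y
    simp only [SimpleGraph.mem_neighborFinset, Finset.mem_biUnion, Finset.mem_filter]
    constructor
    · rintro ⟨h1, h2⟩; exact ⟨⟨h1, h2.symm⟩, x, h1, h2⟩
    · rintro ⟨⟨h1, h2⟩, -⟩; exact ⟨h1, h2.symm⟩
  rw [hcomm]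
  calc _ ≤ ∑ u ∈ X.biUnion (fun v => G.neighborFinset v), D * ‖ψ u‖ ^ 2 := by
        refine Finset.sum_le_sum fun u _ => ?_
        rw [Finset.sum_const, nsmul_eq_mul]
        gcongr
        refine le_trans (Finset.card_le_card fun v hv => ?_) (hD u)
        rw [SimpleGraph.mem_neighborFinset]
        exact (Finset.mem_filter.1 hv).2
    _ ≤ D * ‖ψ‖ ^ 2 := by
        rw [← Finset.mul_sum]
        gcongr
        exact sum_norm_sq_le_lp ψ _

namespace JacobiMatrix

variable {V : Type u} {G : SimpleGraph V}

/-- The commutator of the operator with a cutoff involves only differences of the cutoff along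
edges. -/
theorem act_mul [G.LocallyFinite] (J : JacobiMatrix G) (χ : V → ℝ) (ψ : V → ℂ) (z : ℂ) (x : V) :
    J.act (fun v => χ v * ψ v) x - z * (χ x * ψ x) = χ x * (J.act ψ x - z * ψ x) +
      ∑ u ∈ G.neighborFinset x, (J.a u x * (χ u - χ x) : ℝ) * ψ u := by
  have h : ∀ u, ((J.a u x * (χ u - χ x) : ℝ) : ℂ) * ψ u =
      J.a u x * (χ u * ψ u) - χ x * (J.a u x * ψ u) := fun u => by push_cast; ring
  simp only [h, Finset.sum_sub_distrib, ← Finset.mul_sum, act]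
  ring

theorem norm_act_mul_sq_le [G.LocallyFinite] (J : JacobiMatrix G) {D : ℕ}
    (hD : ∀ v, G.degree v ≤ D) {A : ℝ} (hA : ∀ u v, G.Adj u v → J.a u v ≤ A) (χ : V → ℝ)
    (ψ : V → ℂ) (z : ℂ) (x : V) :
    ‖J.act (fun v => χ v * ψ v) x - z * (χ x * ψ x)‖ ^ 2 ≤
      2 * (χ x ^ 2 * ‖J.act ψ x - z * ψ x‖ ^ 2) +
      2 * D * A ^ 2 * ∑ u ∈ G.neighborFinset x, (χ u - χ x) ^ 2 * ‖ψ u‖ ^ 2 := by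
  rw [act_mul]
  set s := ∑ u ∈ G.neighborFinset x, ((J.a u x * (χ u - χ x) : ℝ) : ℂ) * ψ u with hs
  have h1 : ‖s‖ ^ 2 ≤ D * (A ^ 2 * ∑ u ∈ G.neighborFinset x, (χ u - χ x) ^ 2 * ‖ψ u‖ ^ 2) := by
    calc ‖s‖ ^ 2 ≤ (∑ u ∈ G.neighborFinset x, ‖((J.a u x * (χ u - χ x) : ℝ) : ℂ) * ψ u‖) ^ 2 :=
          pow_le_pow_left₀ (norm_nonneg _) (norm_sum_le _ _) 2
      _ ≤ (G.neighborFinset x).card *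
            ∑ u ∈ G.neighborFinset x, ‖((J.a u x * (χ u - χ x) : ℝ) : ℂ) * ψ u‖ ^ 2 :=
          sq_sum_le_card_mul_sum_sq
      _ ≤ _ := by
          refine mul_le_mul (by exact_mod_cast hD x) ?_ (by positivity) (by positivity)
          rw [Finset.mul_sum]
          refine Finset.sum_le_sum fun u hu => ?_
          have hadj : G.Adj u x := by
            rw [SimpleGraph.mem_neighborFinset] at hu; exact hu.symm
          rw [norm_mul, mul_pow, Complex.norm_real, Real.norm_eq_abs, sq_abs, mul_pow, mul_assoc]
          exact mul_le_mul_of_nonneg_right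
            (pow_le_pow_left₀ (J.a_nonneg u x hadj) (hA u x hadj) 2) (by positivity)
  have h2 : ‖(χ x : ℂ) * (J.act ψ x - z * ψ x)‖ ^ 2 = χ x ^ 2 * ‖J.act ψ x - z * ψ x‖ ^ 2 := by
    rw [norm_mul, mul_pow, Complex.norm_real, Real.norm_eq_abs, sq_abs]
  have h3 := pow_le_pow_left₀ (norm_nonneg _)
    (norm_add_le ((χ x : ℂ) * (J.act ψ x - z * ψ x)) s) 2
  have h4 := add_sq_le (a := ‖(χ x : ℂ) * (J.act ψ x - z * ψ x)‖) (b := ‖s‖)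
  linarith

/-- Localization of approximate eigenvectors: if every edge joins a vertex to its image under `p`,
then a finitely supported approximate eigenvector can be cut down to the set of vertices having a
common ancestor of order less than `R` with respect to `p`. -/
theorem exists_localized [G.LocallyFinite] (J : JacobiMatrix G) (hG : HasBoundedDegree G) {D : ℕ}
    (hD : ∀ v, G.degree v ≤ D) {A : ℝ} (hA : ∀ u v, G.Adj u v → J.a u v ≤ A) {p : V → V}
    (hp : ∀ x y, G.Adj x y → p x = y ∨ p y = x) {R : ℕ} (hR : 0 < R) {S : Finset V}
    (hSR : ∀ x ∈ S, (iterateFinset p R x).card = R) {ψ : ℓ²(V, ℂ)} (hψ : ψ ≠ 0)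
    (hψS : ∀ v ∉ S, ψ v = 0) {z : ℂ} {ε : ℝ} (hε : ‖J.op hG ψ - z • ψ‖ ≤ ε * ‖ψ‖) :
    ∃ w, ∃ φ : ℓ²(V, ℂ), φ ≠ 0 ∧ (∀ x, φ x ≠ 0 → x ∈ S ∧ w ∈ iterateFinset p R x) ∧
      ‖J.op hG φ - z • φ‖ ^ 2 ≤ (2 * ε ^ 2 + 4 * D ^ 2 * A ^ 2 / R) * ‖φ‖ ^ 2 := by
  classical
  set χ := iterateIndicator p R with hχ
  have hχsq : ∀ w x, χ w x ^ 2 = χ w x := fun w x => by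
    simp only [hχ, iterateIndicator]; split_ifs <;> norm_num
  set φ : V → ℓ²(V, ℂ) := fun w => lpPush id S fun x => (χ w x : ℂ) * ψ x with hφ
  have hφx : ∀ w x, φ w x = χ w x * ψ x := fun w x => by
    rw [hφ, lpPush_id_apply]
    split_ifs with h
    · rfl
    · rw [hψS x h, mul_zero]
  have hφS : ∀ w, ∀ v ∉ S, φ w v = 0 := fun w v hv => by rw [hφx, hψS v hv, mul_zero]
  set Z := S.biUnion (iterateFinset p R) with hZ
  set X := S ∪ S.biUnion fun x => G.neighborFinset x with hX
  set η := J.op hG ψ - z • ψ with hη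
  have hηx : ∀ x, η x = J.act ψ x - z * ψ x := fun x => rfl
  have hEx : ∀ w x, (J.op hG (φ w) - z • φ w) x =
      J.act (fun v => χ w v * ψ v) x - z * (χ w x * ψ x) := fun w x => by
    have h1 : (φ w : V → ℂ) = fun v => (χ w v : ℂ) * ψ v := funext (hφx w)
    change J.act (φ w) x - z * φ w x = _
    rw [h1]
  have hE0 : ∀ w, ∀ x ∉ X, (J.op hG (φ w) - z • φ w) x = 0 := by
    intro w x hx
    simp only [hX, Finset.mem_union, Finset.mem_biUnion, not_or, not_exists, not_and,
      SimpleGraph.mem_neighborFinset] at hx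
    change J.act (φ w) x - z * φ w x = 0
    rw [hφS w x hx.1, mul_zero, sub_zero, act, hφS w x hx.1, mul_zero, add_zero]
    refine Finset.sum_eq_zero fun u hu => ?_
    rw [SimpleGraph.mem_neighborFinset] at hu
    rw [hφS w u fun h => hx.2 u h hu.symm, mul_zero]
  have hψp : 0 < ‖ψ‖ ^ 2 := by have := norm_pos_iff.2 hψ; positivity
  -- Each vertex of `S` has exactly R distinct iterates, so it is counted R times.
  have hsumφ : ∑ w ∈ Z, ‖φ w‖ ^ 2 = R * ‖ψ‖ ^ 2 := by
    simp_rw [fun w => norm_sq_lp (φ w) (hφS w), hφx]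
    rw [Finset.sum_comm, norm_sq_lp ψ hψS, Finset.mul_sum]
    refine Finset.sum_congr rfl fun x hx => ?_
    simp_rw [norm_mul, mul_pow, Complex.norm_real, Real.norm_eq_abs, sq_abs, hχsq]
    rw [← Finset.sum_mul, hχ, sum_iterateIndicator_eq p R x
      (Finset.subset_biUnion_of_mem (iterateFinset p R) hx), hSR x hx]
  have hpt : ∀ x, ∑ w ∈ Z, ‖(J.op hG (φ w) - z • φ w) x‖ ^ 2 ≤
      2 * R * ‖η x‖ ^ 2 + 4 * D * A ^ 2 * ∑ u ∈ G.neighborFinset x, ‖ψ u‖ ^ 2 := by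
    intro x
    calc ∑ w ∈ Z, ‖(J.op hG (φ w) - z • φ w) x‖ ^ 2
        ≤ ∑ w ∈ Z, (2 * (χ w x * ‖η x‖ ^ 2) + 2 * D * A ^ 2 *
            ∑ u ∈ G.neighborFinset x, (χ w u - χ w x) ^ 2 * ‖ψ u‖ ^ 2) := by
          refine Finset.sum_le_sum fun w _ => ?_
          have := J.norm_act_mul_sq_le hD hA (χ w) ψ z x
          rw [hχsq] at this
          rw [hEx, hηx]
          exact this
      _ = 2 * ((∑ w ∈ Z, χ w x) * ‖η x‖ ^ 2) + 2 * D * A ^ 2 *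
            ∑ u ∈ G.neighborFinset x, (∑ w ∈ Z, (χ w u - χ w x) ^ 2) * ‖ψ u‖ ^ 2 := by
          rw [Finset.sum_add_distrib, ← Finset.mul_sum, ← Finset.mul_sum, ← Finset.sum_mul,
            Finset.sum_comm]
          simp_rw [Finset.sum_mul]
      _ ≤ 2 * (R * ‖η x‖ ^ 2) + 2 * D * A ^ 2 *
            ∑ u ∈ G.neighborFinset x, 2 * ‖ψ u‖ ^ 2 := by
          gcongr with u hu
          · exact sum_iterateIndicator_le p R x Z
          · exact sum_iterateIndicator_sub_sq_le
              (hp x u ((SimpleGraph.mem_neighborFinset _ _ _).1 hu)) R Z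
      _ = _ := by rw [← Finset.mul_sum]; ring
  -- The original error is multiplied by R just like the mass, the commutator part is not; dividing
  -- by R‖ψ‖² leaves the 1 / R. Some w then satisfies the averaged inequality.
  have hsumE : ∑ w ∈ Z, ‖J.op hG (φ w) - z • φ w‖ ^ 2 ≤
      (2 * ε ^ 2 + 4 * D ^ 2 * A ^ 2 / R) * ∑ w ∈ Z, ‖φ w‖ ^ 2 := by
    simp_rw [fun w => norm_sq_lp (J.op hG (φ w) - z • φ w) (hE0 w)]
    rw [Finset.sum_comm, hsumφ]
    have hR' : (0 : ℝ) < R := by exact_mod_cast hR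
    calc _ ≤ ∑ x ∈ X, (2 * R * ‖η x‖ ^ 2 +
            4 * D * A ^ 2 * ∑ u ∈ G.neighborFinset x, ‖ψ u‖ ^ 2) :=
          Finset.sum_le_sum fun x _ => hpt x
      _ = 2 * R * ∑ x ∈ X, ‖η x‖ ^ 2 +
            4 * D * A ^ 2 * ∑ x ∈ X, ∑ u ∈ G.neighborFinset x, ‖ψ u‖ ^ 2 := by
          rw [Finset.sum_add_distrib, ← Finset.mul_sum, ← Finset.mul_sum]
      _ ≤ 2 * R * (ε * ‖ψ‖) ^ 2 + 4 * D * A ^ 2 * (D * ‖ψ‖ ^ 2) := by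
          gcongr
          · exact (sum_norm_sq_le_lp η X).trans (pow_le_pow_left₀ (norm_nonneg _) hε 2)
          · exact SimpleGraph.sum_sum_neighborFinset_le hD ψ X
      _ = _ := by field_simp
  by_contra! hcon
  have hlt : ∀ w ∈ Z, φ w ≠ 0 → (2 * ε ^ 2 + 4 * D ^ 2 * A ^ 2 / R) * ‖φ w‖ ^ 2 <
      ‖J.op hG (φ w) - z • φ w‖ ^ 2 := by
    intro w _ h0
    refine hcon w (φ w) h0 fun x hx => ⟨?_, ?_⟩
    · by_contra h; exact hx (hφS w x h)
    · by_contra h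
      refine hx ?_
      rw [hφx, hχ, iterateIndicator, if_neg h]
      simp
  obtain ⟨w₀, hw₀, hφw₀⟩ : ∃ w ∈ Z, φ w ≠ 0 := by
    by_contra! h
    have h1 : ∑ w ∈ Z, ‖φ w‖ ^ 2 = 0 := Finset.sum_eq_zero fun w hw => by simp [h w hw]
    rw [hsumφ] at h1
    have : (0 : ℝ) < R := by exact_mod_cast hR
    have : 0 < (R : ℝ) * ‖ψ‖ ^ 2 := by positivity
    linarith
  rw [Finset.mul_sum] at hsumE
  refine absurd hsumE (not_le.2 (Finset.sum_lt_sum (fun w hw => ?_) ⟨w₀, hw₀, hlt w₀ hw₀ hφw₀⟩))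
  by_cases h0 : φ w = 0
  · simp [h0]
  · exact (hlt w hw h0).le

end JacobiMatrix

/-! ### Rooted trees: parents and distances. -/

namespace SimpleGraph

variable {V : Type u} {T : SimpleGraph V}

theorem Connected.exists_adj_dist_add_one (hT : T.Connected) {o x : V} (hx : x ≠ o) :
    ∃ y, T.Adj x y ∧ T.dist o x = T.dist o y + 1 := by
  obtain ⟨p, hp⟩ := hT.exists_walk_length_eq_dist x o
  cases p with
  | nil => exact absurd rfl hx
  | @cons _ y _ h q =>
    refine ⟨y, h, le_antisymm ?_ ?_⟩
    · have h1 := hT.dist_triangle (u := o) (v := y) (w := x)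
      rw [dist_eq_one_iff_adj.2 h.symm] at h1
      exact h1
    · rw [dist_comm (u := o) (v := x), ← hp, Walk.length_cons, dist_comm]
      exact Nat.succ_le_succ (dist_le q)

/-- Continuing from each neighbour by a geodesic gives two paths from x to `o`, which coincide in a
tree. -/
theorem IsTree.eq_of_adj_of_dist (hT : T.IsTree) {o x y y' : V} (h : T.Adj x y)
    (hd : T.dist o x = T.dist o y + 1) (h' : T.Adj x y') (hd' : T.dist o x = T.dist o y' + 1) :
    y = y' := by
  obtain ⟨q, hq⟩ := hT.connected.exists_walk_length_eq_dist y o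
  obtain ⟨q', hq'⟩ := hT.connected.exists_walk_length_eq_dist y' o
  have h1 : (Walk.cons h q).IsPath := Walk.isPath_of_length_eq_dist _ (by
    rw [Walk.length_cons, hq, dist_comm, dist_comm (u := x), hd])
  have h2 : (Walk.cons h' q').IsPath := Walk.isPath_of_length_eq_dist _ (by
    rw [Walk.length_cons, hq', dist_comm, dist_comm (u := x), hd'])
  have h3 := (hT.isAcyclic.subsingleton_path x o).elim ⟨_, h1⟩ ⟨_, h2⟩
  have h4 := congrArg Subtype.val h3
  injection h4

open Classical in
/-- The neighbour of `x` closer to the root `o`, and `o` itself for `x = o`. -/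
noncomputable def treeParent (T : SimpleGraph V) (o x : V) : V :=
  if h : ∃ y, T.Adj x y ∧ T.dist o x = T.dist o y + 1 then h.choose else x

theorem treeParent_spec (hT : T.Connected) {o x : V} (hx : x ≠ o) :
    T.Adj x (T.treeParent o x) ∧ T.dist o x = T.dist o (T.treeParent o x) + 1 := by
  have h := hT.exists_adj_dist_add_one hx
  rw [treeParent, dif_pos h]
  exact h.choose_spec

theorem treeParent_self (T : SimpleGraph V) (o : V) : T.treeParent o o = o := by
  rw [treeParent, dif_neg]
  simp

theorem IsTree.treeParent_eq (hT : T.IsTree) {o x y : V} (h : T.Adj x y)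
    (hd : T.dist o x = T.dist o y + 1) : T.treeParent o x = y := by
  have hx : x ≠ o := by
    rintro rfl
    rw [dist_self] at hd
    omega
  obtain ⟨h1, h2⟩ := treeParent_spec hT.connected hx
  exact hT.eq_of_adj_of_dist h1 h2 h hd

theorem IsTree.treeParent_eq_or_eq (hT : T.IsTree) (o : V) {x y : V} (h : T.Adj x y) :
    T.treeParent o x = y ∨ T.treeParent o y = x :=
  (hT.dist_eq_dist_add_one_of_adj o h).imp (hT.treeParent_eq h) (hT.treeParent_eq h.symm)

theorem dist_iterate_treeParent (hT : T.Connected) (o x : V) (k : ℕ) :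
    T.dist o ((T.treeParent o)^[k] x) = T.dist o x - k := by
  induction k generalizing x with
  | zero => rfl
  | succ k ih =>
    rw [Function.iterate_succ_apply, ih]
    by_cases hx : x = o
    · subst hx
      simp [treeParent_self]
    · rw [(treeParent_spec hT hx).2]
      omega

theorem dist_iterate_treeParent_le (hT : T.Connected) (o x : V) (k : ℕ) :
    T.dist x ((T.treeParent o)^[k] x) ≤ k := by
  induction k generalizing x with
  | zero => simp
  | succ k ih =>
    rw [Function.iterate_succ_apply]
    have h1 := ih (T.treeParent o x)
    have h2 : T.dist x (T.treeParent o x) ≤ 1 := by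
      by_cases hx : x = o
      · subst hx
        simp [treeParent_self]
      · exact (dist_eq_one_iff_adj.2 (treeParent_spec hT hx).1).le
    have h3 := hT.dist_triangle (u := x) (v := T.treeParent o x)
      (w := (T.treeParent o)^[k] (T.treeParent o x))
    omega

theorem card_iterateFinset_treeParent (hT : T.Connected) {o x : V} {R : ℕ}
    (hx : R ≤ T.dist o x) : (iterateFinset (T.treeParent o) R x).card = R := by
  classical
  rw [iterateFinset, Finset.card_image_of_injOn, Finset.card_range]
  intro k hk l hl h
  rw [Finset.coe_range, Set.mem_Iio] at hk hl
  have := congrArg (T.dist o) h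
  simp only [dist_iterate_treeParent hT] at this
  omega

theorem treeParent_induction (hT : T.Connected) {o : V} {P : V → Prop} (h0 : P o)
    (h : ∀ x, x ≠ o → P (T.treeParent o x) → P x) (x : V) : P x := by
  induction hn : T.dist o x generalizing x with
  | zero =>
    rw [hT.dist_eq_zero_iff] at hn
    exact hn ▸ h0
  | succ n ih =>
    have hx : x ≠ o := by
      rintro rfl
      rw [dist_self] at hn
      omega
    refine h x hx (ih _ ?_)
    have := (treeParent_spec hT hx).2
    omega

theorem Iso.dist_eq {W : Type w} {F : SimpleGraph W} (hT : T.Connected) (hF : F.Connected)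
    (g : T ≃g F) (x y : V) : F.dist (g x) (g y) = T.dist x y := by
  apply le_antisymm
  · obtain ⟨p, hp⟩ := hT.exists_walk_length_eq_dist x y
    rw [← hp, ← Walk.length_map (f := g.toHom) (p := p)]
    exact dist_le _
  · obtain ⟨p, hp⟩ := hF.exists_walk_length_eq_dist (g x) (g y)
    rw [← hp, ← Walk.length_map (f := g.symm.toHom) (p := p)]
    have : T.dist (g.symm (g x)) (g.symm (g y)) ≤ _ := dist_le (p.map g.symm.toHom)
    simpa only [RelIso.symm_apply_apply] using this

/-! ### Homogeneity of regular trees. -/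

section Homogeneous

variable [T.LocallyFinite]

/-- The neighbours of `y` which are further away from the root `o`. -/
noncomputable def treeChildren (T : SimpleGraph V) [T.LocallyFinite] (o y : V) : Finset V :=
  {x ∈ T.neighborFinset y | T.dist o x = T.dist o y + 1}

theorem mem_treeChildren {o x y : V} :
    x ∈ T.treeChildren o y ↔ T.Adj y x ∧ T.dist o x = T.dist o y + 1 := by
  rw [treeChildren, Finset.mem_filter, mem_neighborFinset]

theorem IsTree.treeParent_of_mem (hT : T.IsTree) {o x y : V} (hx : x ∈ T.treeChildren o y) :
    T.treeParent o x = y :=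
  hT.treeParent_eq (mem_treeChildren.1 hx).1.symm (mem_treeChildren.1 hx).2

theorem mem_treeChildren_treeParent (hT : T.Connected) {o x : V} (hx : x ≠ o) :
    x ∈ T.treeChildren o (T.treeParent o x) := by
  obtain ⟨h1, h2⟩ := treeParent_spec hT hx
  exact mem_treeChildren.2 ⟨h1.symm, h2⟩

/-- The count depends only on whether y is the root, as any other vertex loses one neighbour to its
parent. This is where regularity enters. -/
theorem IsTree.card_treeChildren (hT : T.IsTree) {d : ℕ} (hd : T.IsRegularOfDegree d) (o y : V)
    [Decidable (y = o)] :
    (T.treeChildren o y).card = if y = o then d else d - 1 := by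
  classical
  split_ifs with h
  · subst h
    rw [← hd y, ← card_neighborFinset_eq_degree]
    congr 1
    ext x
    rw [mem_treeChildren, mem_neighborFinset, dist_self, zero_add]
    exact ⟨fun h => h.1, fun h => ⟨h, dist_eq_one_iff_adj.2 h⟩⟩
  · have h1 := treeParent_spec hT.connected h
    have h2 : T.treeParent o y ∈ T.neighborFinset y := (mem_neighborFinset _ _ _).2 h1.1
    rw [← hd y, ← card_neighborFinset_eq_degree, ← Finset.card_erase_of_mem h2]
    congr 1
    ext x
    rw [mem_treeChildren, Finset.mem_erase, mem_neighborFinset]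
    constructor
    · rintro ⟨h3, h4⟩
      refine ⟨?_, h3⟩
      rintro rfl
      omega
    · rintro ⟨h3, h4⟩
      refine ⟨h4, (hT.dist_eq_dist_add_one_of_adj o h4).resolve_left fun h5 => h3 ?_⟩
      exact (hT.treeParent_eq h4 h5).symm

open Classical in
/-- The position of `x` among the children of its parent. -/
noncomputable def treeIndex (T : SimpleGraph V) [T.LocallyFinite] (o x : V) : ℕ :=
  if h : x ∈ T.treeChildren o (T.treeParent o x) then
    (T.treeChildren o (T.treeParent o x)).equivFin ⟨x, h⟩ else 0

open Classical in
/-- The `i`-th child of `y`. -/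
noncomputable def treeChild (T : SimpleGraph V) [T.LocallyFinite] (o y : V) (i : ℕ) : V :=
  if h : i < (T.treeChildren o y).card then (T.treeChildren o y).equivFin.symm ⟨i, h⟩ else y

theorem treeChild_mem {o y : V} {i : ℕ} (hi : i < (T.treeChildren o y).card) :
    T.treeChild o y i ∈ T.treeChildren o y := by
  rw [treeChild, dif_pos hi]
  exact Subtype.prop _

theorem IsTree.treeIndex_treeChild (hT : T.IsTree) {o y : V} {i : ℕ}
    (hi : i < (T.treeChildren o y).card) : T.treeIndex o (T.treeChild o y i) = i := by
  have h1 := treeChild_mem hi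
  have h2 := hT.treeParent_of_mem h1
  have key : ∀ z (_ : z = y) (h : T.treeChild o y i ∈ T.treeChildren o z),
      ((T.treeChildren o z).equivFin ⟨_, h⟩ : ℕ) = i := by
    rintro z rfl h
    simp only [treeChild, dif_pos hi]
    simp
  rw [treeIndex, dif_pos (by rw [h2]; exact h1)]
  exact key _ h2 _

theorem treeIndex_lt (hT : T.Connected) {o x : V} (hx : x ≠ o) :
    T.treeIndex o x < (T.treeChildren o (T.treeParent o x)).card := by
  rw [treeIndex, dif_pos (mem_treeChildren_treeParent hT hx)]
  exact Fin.is_lt _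

theorem treeChild_treeIndex (hT : T.Connected) {o x : V} (hx : x ≠ o) :
    T.treeChild o (T.treeParent o x) (T.treeIndex o x) = x := by
  rw [treeChild, dif_pos (treeIndex_lt hT hx)]
  simp only [treeIndex, dif_pos (mem_treeChildren_treeParent hT hx)]
  simp

/-- Auxiliary recursion for `treeMap`. -/
noncomputable def treeMapAux (T : SimpleGraph V) [T.LocallyFinite] (o v : V) : ℕ → V → V
  | 0, _ => v
  | n + 1, x => T.treeChild v (treeMapAux T o v n (T.treeParent o x)) (T.treeIndex o x)

/-- The map sending `o` to `v` and the `i`-th child of a vertex, with respect to the root `o`, to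
the `i`-th child of the image, with respect to the root `v`. -/
noncomputable def treeMap (T : SimpleGraph V) [T.LocallyFinite] (o v x : V) : V :=
  treeMapAux T o v (T.dist o x) x

theorem treeMap_root (T : SimpleGraph V) [T.LocallyFinite] (o v : V) : T.treeMap o v o = v := by
  rw [treeMap, dist_self, treeMapAux]

theorem treeMap_of_ne (hT : T.Connected) {o v x : V} (hx : x ≠ o) :
    T.treeMap o v x = T.treeChild v (T.treeMap o v (T.treeParent o x)) (T.treeIndex o x) := by
  rw [treeMap, (treeParent_spec hT hx).2, treeMapAux, treeMap]

/-- Proved by induction from the root: preserving distances, the map sends only the root to the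
root, so a vertex and its image have equally many children. The index is then in range and
`treeChild` never takes its default value. -/
theorem IsTree.dist_treeMap (hT : T.IsTree) {d : ℕ} (hd : T.IsRegularOfDegree d) (o v x : V) :
    T.dist v (T.treeMap o v x) = T.dist o x := by
  classical
  refine treeParent_induction hT.connected (o := o)
    (P := fun x => T.dist v (T.treeMap o v x) = T.dist o x) ?_ (fun x hx ih => ?_) x
  · rw [treeMap_root, dist_self, dist_self]
  · have h1 : T.treeIndex o x < (T.treeChildren v (T.treeMap o v (T.treeParent o x))).card := by
      have h2 := treeIndex_lt hT.connected hx
      rw [hT.card_treeChildren hd] at h2 ⊢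
      have h3 : T.treeMap o v (T.treeParent o x) = v ↔ T.treeParent o x = o := by
        rw [eq_comm, ← hT.connected.dist_eq_zero_iff, ih, hT.connected.dist_eq_zero_iff, eq_comm]
      simpa only [h3] using h2
    rw [treeMap_of_ne hT.connected hx, (mem_treeChildren.1 (treeChild_mem h1)).2, ih,
      ← (treeParent_spec hT.connected hx).2]

theorem IsTree.treeIndex_lt_treeMap (hT : T.IsTree) {d : ℕ} (hd : T.IsRegularOfDegree d)
    (o v : V) {x : V} (hx : x ≠ o) :
    T.treeIndex o x < (T.treeChildren v (T.treeMap o v (T.treeParent o x))).card := by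
  classical
  have h2 := treeIndex_lt hT.connected hx
  rw [hT.card_treeChildren hd] at h2 ⊢
  have h3 : T.treeMap o v (T.treeParent o x) = v ↔ T.treeParent o x = o := by
    rw [eq_comm, ← hT.connected.dist_eq_zero_iff, hT.dist_treeMap hd,
      hT.connected.dist_eq_zero_iff, eq_comm]
  simpa only [h3] using h2

theorem IsTree.treeParent_treeMap (hT : T.IsTree) {d : ℕ} (hd : T.IsRegularOfDegree d) (o v : V)
    {x : V} (hx : x ≠ o) :
    T.treeParent v (T.treeMap o v x) = T.treeMap o v (T.treeParent o x) := by
  rw [treeMap_of_ne hT.connected hx]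
  exact hT.treeParent_of_mem (treeChild_mem (hT.treeIndex_lt_treeMap hd o v hx))

theorem IsTree.treeMap_treeMap (hT : T.IsTree) {d : ℕ} (hd : T.IsRegularOfDegree d)
    (o v x : V) : T.treeMap v o (T.treeMap o v x) = x := by
  refine treeParent_induction hT.connected (o := o)
    (P := fun x => T.treeMap v o (T.treeMap o v x) = x) ?_ (fun x hx ih => ?_) x
  · rw [treeMap_root, treeMap_root]
  · have hne : T.treeMap o v x ≠ v := by
      intro h
      have := hT.dist_treeMap hd o v x
      rw [h, dist_self] at this
      exact hx (hT.connected.dist_eq_zero_iff.1 this.symm).symm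
    rw [treeMap_of_ne hT.connected hne, hT.treeParent_treeMap hd o v hx, ih]
    have : T.treeIndex v (T.treeMap o v x) = T.treeIndex o x := by
      rw [treeMap_of_ne hT.connected hx]
      exact hT.treeIndex_treeChild (hT.treeIndex_lt_treeMap hd o v hx)
    rw [this, treeChild_treeIndex hT.connected hx]

theorem IsTree.adj_treeMap (hT : T.IsTree) {d : ℕ} (hd : T.IsRegularOfDegree d) (o v : V)
    {x y : V} (h : T.Adj x y) : T.Adj (T.treeMap o v x) (T.treeMap o v y) := by
  have key : ∀ x y, T.Adj x y → T.dist o x = T.dist o y + 1 →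
      T.Adj (T.treeMap o v x) (T.treeMap o v y) := by
    intro x y h h1
    have hx : x ≠ o := by
      rintro rfl
      rw [dist_self] at h1
      omega
    have h2 := treeChild_mem (hT.treeIndex_lt_treeMap hd o v hx)
    rw [← treeMap_of_ne hT.connected hx, hT.treeParent_eq h h1] at h2
    exact (mem_treeChildren.1 h2).1.symm
  rcases hT.dist_eq_dist_add_one_of_adj o h with h1 | h1
  · exact key x y h h1
  · exact (key y x h.symm h1).symm

/-- A regular tree is homogeneous. -/
theorem IsTree.exists_iso (hT : T.IsTree) {d : ℕ} (hd : T.IsRegularOfDegree d) (o v : V) :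
    ∃ g : T ≃g T, g o = v :=
  ⟨{ toFun := T.treeMap o v
     invFun := T.treeMap v o
     left_inv := hT.treeMap_treeMap hd o v
     right_inv := hT.treeMap_treeMap hd v o
     map_rel_iff' := fun {x y} => ⟨fun h => by
       have := hT.adj_treeMap hd v o h
       simpa only [Equiv.coe_fn_mk, hT.treeMap_treeMap hd] using this, hT.adj_treeMap hd o v⟩ },
    treeMap_root T o v⟩

end Homogeneous

end SimpleGraph

/-! ### Existence of coherent enumerations and their images under automorphisms. -/

section Enumerations

variable {V : Type u} {G : SimpleGraph V}

theorem SimpleGraph.Connected.finite_graphBall [G.LocallyFinite] (hG : G.Connected) (v : V) (r : ℕ) :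
    (graphBall G v r).Finite := by
  classical
  induction r with
  | zero =>
    refine (Set.finite_singleton v).subset fun x hx => ?_
    exact hG.dist_eq_zero_iff.1 (Nat.le_zero.1 hx)
  | succ r ih =>
    refine (ih.union (ih.biUnion fun x _ => (G.neighborFinset x).finite_toSet)).subset
      fun x hx => ?_
    rcases Nat.lt_or_ge r (G.dist x v) with h | h
    · have hxv : x ≠ v := by
        rintro rfl
        simp at h
      obtain ⟨y, hy, hd⟩ := hG.exists_adj_dist_add_one hxv
      have hx' : G.dist x v ≤ r + 1 := hx
      refine Or.inr (Set.mem_biUnion (x := y) ?_ ?_)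
      · change G.dist y v ≤ r
        rw [SimpleGraph.dist_comm] at hx' ⊢
        omega
      · exact (SimpleGraph.mem_neighborFinset _ _ _).2 hy.symm
    · exact Or.inl h

theorem SimpleGraph.Connected.countable [G.LocallyFinite] (hG : G.Connected) : Countable V := by
  obtain ⟨v⟩ := hG.nonempty
  have h : (⋃ r, graphBall G v r) = Set.univ :=
    Set.eq_univ_of_forall fun x => Set.mem_iUnion.2 ⟨G.dist x v, le_refl (G.dist x v)⟩
  rw [← Set.countable_univ_iff, ← h]
  exact Set.countable_iUnion fun r => (hG.finite_graphBall v r).countable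

/-- Ordering the vertices by their distance from `v` yields a coherent enumeration. -/
theorem CoherentEnumeration.nonempty [G.LocallyFinite] (hG : G.Connected) (v : V) :
    Nonempty (CoherentEnumeration G v) := by
  have := hG.countable
  obtain ⟨c, hc⟩ := exists_injective_nat V
  set k : V → ℕ ×ₗ ℕ := fun x => toLex (G.dist x v, c x) with hk
  have hkinj : Function.Injective k := fun x y h => hc (congrArg (fun p => (ofLex p).2) h)
  have hkd : ∀ x y, k x ≤ k y → G.dist x v ≤ G.dist y v := fun x y h => by
    rw [hk, Prod.Lex.toLex_le_toLex] at h
    rcases h with h | h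
    · exact h.le
    · exact h.1.le
  -- The rank of x does not mention the radius, so coherence is immediate; ordering by distance
  -- first makes each ball an initial segment.
  set f : V → ℕ := fun x => {y | k y < k x}.ncard with hf
  have hsub : ∀ x r, x ∈ graphBall G v r → {y | k y < k x} ⊆ graphBall G v r :=
    fun x r hx y hy => (hkd y x (le_of_lt hy)).trans hx
  have hlt : ∀ x r, x ∈ graphBall G v r → f x < ballCard G v r := by
    intro x r hx
    rw [ballCard, Nat.card_coe_set_eq]
    refine Set.ncard_lt_ncard ?_ (hG.finite_graphBall v r)
    exact (Set.ssubset_iff_of_subset (hsub x r hx)).2 ⟨x, hx, lt_irrefl (k x)⟩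
  have hmono : ∀ x y, k x < k y → f x < f y := by
    intro x y h
    refine Set.ncard_lt_ncard ((Set.ssubset_iff_of_subset ?_).2 ⟨x, h, lt_irrefl (k x)⟩)
      ((hG.finite_graphBall v _).subset (hsub y _ (le_refl (G.dist y v))))
    exact fun w hw => lt_trans hw h
  have hfinj : Function.Injective f := by
    intro x y h
    rcases lt_trichotomy (k x) (k y) with h1 | h1 | h1
    · exact absurd h (hmono x y h1).ne
    · exact hkinj h1
    · exact absurd h (hmono y x h1).ne'
  have hbij : ∀ r, Function.Bijective fun x : graphBall G v r =>
      (⟨f x, hlt x r x.2⟩ : Fin (ballCard G v r)) := by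
    intro r
    have := (hG.finite_graphBall v r).to_subtype
    refine (Nat.bijective_iff_injective_and_card _).2 ⟨fun x y h => ?_, ?_⟩
    · exact Subtype.ext (hfinj (congrArg Fin.val h))
    · rw [Nat.card_fin, ballCard]
  exact ⟨⟨fun r => Equiv.ofBijective _ (hbij r), fun r s _ _ x hr hs => rfl⟩⟩

theorem mem_graphBall_iso_iff (hG : G.Connected) (g : G ≃g G) (o x : V) (r : ℕ) :
    g x ∈ graphBall G (g o) r ↔ x ∈ graphBall G o r := by
  simp only [graphBall, Set.mem_ofPred_eq, SimpleGraph.Iso.dist_eq hG hG]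

/-- An automorphism identifies balls. -/
def ballEquiv (hG : G.Connected) (g : G ≃g G) (o : V) (r : ℕ) :
    graphBall G o r ≃ graphBall G (g o) r :=
  g.toEquiv.subtypeEquiv fun x => (mem_graphBall_iso_iff hG g o x r).symm

theorem ballCard_iso (hG : G.Connected) (g : G ≃g G) (o : V) (r : ℕ) :
    ballCard G o r = ballCard G (g o) r :=
  Nat.card_congr (ballEquiv hG g o r)

/-- The image of a coherent enumeration under an automorphism. -/
noncomputable def CoherentEnumeration.map (hG : G.Connected) {o : V} (e : CoherentEnumeration G o)
    (g : G ≃g G) : CoherentEnumeration G (g o) where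
  η r := (ballEquiv hG g o r).symm.trans ((e.η r).trans (finCongr (ballCard_iso hG g o r)))
  coherent r s hr hrs x h h' := by
    have hx : ∀ t (ht : x ∈ graphBall G (g o) t), ((ballEquiv hG g o t).symm ⟨x, ht⟩ : V) =
        g.symm x := fun _ _ => rfl
    have h1 : ∀ t, x ∈ graphBall G (g o) t → g.symm x ∈ graphBall G o t := fun t ht => by
      rw [← mem_graphBall_iso_iff hG g, RelIso.apply_symm_apply]
      exact ht
    exact e.coherent r s hr hrs (g.symm x) (h1 r h) (h1 s h')

end Enumerations

/-! ### Limits of translates, and the essential spectrum in terms of R-limits. -/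

namespace JacobiMatrix

variable {V : Type u} {G : SimpleGraph V}

/-- Translates of a bounded Jacobi matrix by automorphisms have a pointwise convergent
subsequence. -/
theorem exists_tendsto_translates [Countable V] (J : JacobiMatrix G) (g : ℕ → G ≃g G) :
    ∃ n : ℕ → ℕ, StrictMono n ∧ ∃ L : JacobiMatrix G,
      (∀ u v, G.Adj u v → Tendsto (fun j => J.a (g (n j) u) (g (n j) v)) atTop (𝓝 (L.a u v))) ∧
      ∀ u, Tendsto (fun j => J.b (g (n j) u)) atTop (𝓝 (L.b u)) := by
  classical
  obtain ⟨A, hA⟩ := J.a_bounded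
  obtain ⟨B, hB⟩ := J.b_bounded
  -- All coefficients together form a point of a countable product of compact intervals. Pairs that
  -- are not edges get 0, because the weights are bounded only on edges.
  let X : ℕ → (V × V) ⊕ V → ℝ := fun j => Sum.elim
    (fun p => if G.Adj p.1 p.2 then J.a (g j p.1) (g j p.2) else 0) fun v => J.b (g j v)
  have hXmem : ∀ j, X j ∈ Set.pi Set.univ fun _ => Set.Icc (-(max |A| |B|)) (max |A| |B|) := by
    rintro j (⟨u, v⟩ | v) -
    · simp only [X, Sum.elim_inl]
      have h0 : 0 ≤ max |A| |B| := (abs_nonneg A).trans (le_max_left _ _)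
      split_ifs with h
      · have h' := (g j).map_adj_iff.2 h
        have h1 := J.a_nonneg _ _ h'
        have h2 := (hA _ _ h').trans ((le_abs_self A).trans (le_max_left _ |B|))
        exact ⟨by linarith, h2⟩
      · exact ⟨by linarith, h0⟩
    · simp only [X, Sum.elim_inr]
      exact abs_le.1 ((hB _).trans ((le_abs_self B).trans (le_max_right _ _)))
  obtain ⟨Y, -, n, hn, hY⟩ := (isCompact_univ_pi fun _ => isCompact_Icc).tendsto_subseq hXmem
  rw [tendsto_pi_nhds] at hY
  have ha : ∀ u v, G.Adj u v →
      Tendsto (fun j => J.a (g (n j) u) (g (n j) v)) atTop (𝓝 (Y (Sum.inl (u, v)))) := by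
    intro u v h
    have := hY (Sum.inl (u, v))
    simpa [X, h] using this
  have hb : ∀ v, Tendsto (fun j => J.b (g (n j) v)) atTop (𝓝 (Y (Sum.inr v))) :=
    fun v => hY (Sum.inr v)
  refine ⟨n, hn, ⟨fun u v => Y (Sum.inl (u, v)), fun v => Y (Sum.inr v), ?_, ?_, ?_, ?_⟩, ha, hb⟩
  · intro u v h
    refine tendsto_nhds_unique (ha u v h) ?_
    convert ha v u h.symm using 2 with j
    exact J.a_symm _ _ ((g (n j)).map_adj_iff.2 h)
  · exact fun u v h => ge_of_tendsto' (ha u v h) fun j =>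
      J.a_nonneg _ _ ((g (n j)).map_adj_iff.2 h)
  · exact ⟨A, fun u v h => le_of_tendsto' (ha u v h) fun j =>
      hA _ _ ((g (n j)).map_adj_iff.2 h)⟩
  · exact ⟨B, fun v => le_of_tendsto' (hb v).abs fun j => hB _⟩

theorem tendsto_entry {J L : JacobiMatrix G} {g : ℕ → G ≃g G}
    (ha : ∀ u v, G.Adj u v → Tendsto (fun j => J.a (g j u) (g j v)) atTop (𝓝 (L.a u v)))
    (hb : ∀ u, Tendsto (fun j => J.b (g j u)) atTop (𝓝 (L.b u))) (u v : V) :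
    Tendsto (fun j => J.entry (g j u) (g j v)) atTop (𝓝 (L.entry u v)) := by
  by_cases h1 : u = v
  · simpa [entry, h1] using hb v
  by_cases h2 : G.Adj u v
  · simpa [entry, (g _).injective.eq_iff, (g _).map_adj_iff, h1, h2] using ha u v h2
  · simp [entry, (g _).injective.eq_iff, (g _).map_adj_iff, h1, h2]

/-- One enumeration at `o`, carried along by the automorphisms, turns the ball matrices into the
entries of the translates; each ball matrix has finitely many of them. -/
theorem isRLimit_of_tendsto_entry (hG : G.Connected) {J L : JacobiMatrix G}
    {o : V} (e : CoherentEnumeration G o) {g : ℕ → G ≃g G} {n : ℕ → ℕ} (hn : StrictMono n)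
    (hent : ∀ u v, Tendsto (fun j => J.entry (g (n j) u) (g (n j) v)) atTop (𝓝 (L.entry u v)))
    {o' : V} (hfar : Tendsto (fun j => G.dist (g j o) o') atTop atTop) : J.IsRLimit L o := by
  refine ⟨fun j => g j o, ⟨o', hfar⟩, n, hn, fun j => e.map hG (g (n j)), e, ?_⟩
  intro r _ ε hε
  have h1 : ∀ᶠ j in atTop, ∀ i k : Fin (ballCard G o r),
      |J.entry (g (n j) ((e.η r).symm i)) (g (n j) ((e.η r).symm k)) -
        L.entry ((e.η r).symm i) ((e.η r).symm k)| < ε := by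
    rw [eventually_all]
    intro i
    rw [eventually_all]
    intro k
    exact (Metric.tendsto_nhds.1 (hent _ _)) ε hε
  filter_upwards [h1] with j hj
  exact ⟨ballCard_iso hG (g (n j)) o r, hj⟩

/-- The localization radius depends on ε, hence so does `L`; this is why the theorem needs a
closure. -/
theorem exists_rLimit_of_mem_essentialSpectrum {T : SimpleGraph V} [T.LocallyFinite]
    (hT : T.IsTree) {d : ℕ} (hd : T.IsRegularOfDegree d) (J : JacobiMatrix T)
    (hG : HasBoundedDegree T) {z : ℂ} (hz : z ∈ essentialSpectrum (J.op hG)) {ε : ℝ}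
    (hε : 0 < ε) :
    ∃ (L : JacobiMatrix T) (o : V), J.IsRLimit L o ∧
      (∀ c, (∀ u v, T.Adj u v → c ≤ J.a u v) → ∀ u v, T.Adj u v → c ≤ L.a u v) ∧
      ∃ t ∈ spectrum ℂ (L.op hG), dist t z ≤ ε := by
  classical
  have hconn := hT.connected
  obtain ⟨o⟩ := hconn.nonempty
  have := hconn.countable
  rw [mem_essentialSpectrum_iff (J.op_isSelfAdjoint hG).isStarNormal] at hz
  obtain ⟨A, hA⟩ := J.a_bounded
  -- Chosen so that with initial error ε / 4 the localized squared error is at most ε² / 8 + ε² / 8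
  -- = (ε / 2)².
  obtain ⟨R, hR⟩ := exists_nat_gt (32 * d ^ 2 * A ^ 2 / ε ^ 2)
  have hR0 : (0 : ℝ) < R := lt_of_le_of_lt (by positivity) hR
  have hRε : 4 * d ^ 2 * A ^ 2 / R ≤ ε ^ 2 / 8 := by
    rw [div_lt_iff₀ (by positivity)] at hR
    rw [div_le_div_iff₀ hR0 (by norm_num)]
    linarith
  have hloc : ∀ n : ℕ, ∃ w, n ≤ T.dist w o ∧ ∃ φ : ℓ²(V, ℂ), φ ≠ 0 ∧
      (∀ x, φ x ≠ 0 → x ∈ graphBall T w R) ∧ ‖J.op hG φ - z • φ‖ ≤ ε / 2 * ‖φ‖ := by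
    intro n
    -- Avoiding the ball of radius n + R makes the R ancestors distinct and keeps all of them at
    -- distance at least n from the root.
    obtain ⟨K, hKF, ψ, hψ0, hψK, hψ⟩ := hz (ε / 4) (by positivity)
      (hconn.finite_graphBall o (n + R)).toFinset
    have hKd : ∀ x ∈ K, n + R < T.dist o x := by
      intro x hx
      have := Finset.disjoint_left.1 hKF hx
      simp only [Set.Finite.mem_toFinset, graphBall, Set.mem_ofPred_eq] at this
      rw [SimpleGraph.dist_comm]
      omega
    obtain ⟨w, φ, hφ0, hφ, hφε⟩ := J.exists_localized hG (fun v => (hd v).le) hA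
      (fun x y h => hT.treeParent_eq_or_eq o h) (by exact_mod_cast hR0)
      (fun x hx => SimpleGraph.card_iterateFinset_treeParent hconn
        (le_trans (Nat.le_add_left R n) (hKd x hx).le)) hψ0 hψK hψ
    have hex : ∃ x, φ x ≠ 0 := by
      by_contra! h
      exact hφ0 (lp.ext (funext h))
    refine ⟨w, ?_, φ, hφ0, fun x hx => ?_, ?_⟩
    · obtain ⟨x, hx⟩ := hex
      obtain ⟨hxK, hxw⟩ := hφ x hx
      obtain ⟨k, hk, rfl⟩ := mem_iterateFinset.1 hxw
      have := hKd x hxK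
      rw [SimpleGraph.dist_comm, SimpleGraph.dist_iterate_treeParent hconn]
      omega
    · obtain ⟨k, hk, rfl⟩ := mem_iterateFinset.1 (hφ x hx).2
      exact (SimpleGraph.dist_iterate_treeParent_le hconn o x k).trans hk.le
    · refine abs_le_of_sq_le_sq' (hφε.trans ?_) (by positivity) |>.2
      rw [mul_pow]
      gcongr
      nlinarith
  choose w hw φ hφ0 hφw hφ using hloc
  choose g hg using hT.exists_iso hd o
  obtain ⟨n, hn, L, ha, hb⟩ := J.exists_tendsto_translates fun j => g (w j)
  have hent := tendsto_entry ha hb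
  obtain ⟨e⟩ := CoherentEnumeration.nonempty hconn o
  refine ⟨L, o, isRLimit_of_tendsto_entry hconn e (g := fun j => g (w j)) hn hent (o' := o) ?_,
    ?_, ?_⟩
  · refine tendsto_atTop_mono (fun j => ?_) tendsto_id
    rw [hg]
    exact hw j
  · exact fun c hc u v h => ge_of_tendsto' (ha u v h) fun j =>
      hc _ _ ((g (w (n j))).map_adj_iff.2 h)
  · set B := (hconn.finite_graphBall o (R + 1)).toFinset with hB
    set S := (hconn.finite_graphBall o R).toFinset with hS
    set δ := ε / (2 * (B.card ^ 2 + 1)) with hδ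
    have hδ0 : 0 < δ := by positivity
    have hev : ∀ᶠ j in atTop, ∀ x ∈ B, ∀ y ∈ B,
        |J.entry (g (w (n j)) x) (g (w (n j)) y) - L.entry x y| < δ := by
      rw [Finset.eventually_all]
      intro x _
      rw [Finset.eventually_all]
      intro y _
      exact (Metric.tendsto_nhds.1 (hent x y)) δ hδ0
    obtain ⟨j, hj⟩ := hev.exists
    set γ := g (w (n j)) with hγ
    have hγo : γ o = w (n j) := hg _
    have hSB : S ⊆ B := fun x hx => by
      simp only [hS, hB, Set.Finite.mem_toFinset] at hx ⊢
      exact le_trans hx (Nat.le_succ R)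
    -- The transport runs from `J` to `L`, hence along the inverse automorphism; one sufficiently
    -- large j is enough.
    obtain ⟨ψ, -, hψn, hψ⟩ := L.exists_transport J hG hG (σ := γ.symm) (K := B.image γ)
      (S := S.image γ) γ.symm.injective.injOn (Finset.image_subset_image hSB) (by
        intro _ hy' x hadj
        obtain ⟨y, hy, rfl⟩ := Finset.mem_image.1 hy'
        rw [RelIso.symm_apply_apply] at hadj
        refine ⟨γ x, Finset.mem_image_of_mem _ ?_, RelIso.symm_apply_apply _ _⟩
        simp only [hS, hB, Set.Finite.mem_toFinset, graphBall, Set.mem_ofPred_eq] at hy ⊢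
        have h1 := hconn.dist_triangle (u := x) (v := y) (w := o)
        rw [SimpleGraph.dist_eq_one_iff_adj.2 hadj.symm] at h1
        omega) (φ := φ (n j)) (by
        intro x hx
        by_contra h
        refine hx (Finset.mem_image.2 ⟨γ.symm x, ?_, RelIso.apply_symm_apply _ _⟩)
        have h1 := hφw (n j) x h
        rw [← hγo] at h1
        rw [hS, Set.Finite.mem_toFinset, ← mem_graphBall_iso_iff hconn γ,
          RelIso.apply_symm_apply]
        exact h1) hδ0.le (by
        intro _ hx' _ hy'
        obtain ⟨x, hx, rfl⟩ := Finset.mem_image.1 hx'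
        obtain ⟨y, hy, rfl⟩ := Finset.mem_image.1 hy'
        rw [RelIso.symm_apply_apply, RelIso.symm_apply_apply, abs_sub_comm]
        exact (hj x hx y hy).le) z
    refine exists_mem_spectrum_dist_le (L.op_isSelfAdjoint hG).isStarNormal (x := ψ) ?_ ?_
    · rw [← norm_ne_zero_iff, hψn]
      exact norm_ne_zero_iff.2 (hφ0 _)
    · rw [hψn]
      have h1 : ((B.image γ).card : ℝ) ^ 2 * δ ≤ ε / 2 := by
        rw [Finset.card_image_of_injective _ γ.injective, hδ, ← mul_div_assoc,
          div_le_div_iff₀ (by positivity) (by norm_num)]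
        nlinarith
      have h2 := hφ (n j)
      nlinarith [norm_nonneg (φ (n j))]

end JacobiMatrix

theorem theorem4 {V : Type u} (T : SimpleGraph V) [T.LocallyFinite] (hT : T.IsTree)
    (d : ℕ) (hd : T.IsRegularOfDegree d) (J : JacobiMatrix T) :
    essentialSpectrum (J.op ⟨d, fun v => (hd v).le⟩) = closure J.rLimitSpectra ∧
    ((∃ c : ℝ, 0 < c ∧ ∀ u v, T.Adj u v → c ≤ J.a u v) →
      essentialSpectrum (J.op ⟨d, fun v => (hd v).le⟩) = closure J.positiveRLimitSpectra) := by
  have hG : HasBoundedDegree T := ⟨d, fun v => (hd v).le⟩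
  have hsub := J.closure_rLimitSpectra_subset hT.connected hG
  refine ⟨Set.Subset.antisymm (fun z hz => ?_) hsub, fun ⟨c, hc, hcJ⟩ =>
    Set.Subset.antisymm (fun z hz => ?_) (subset_trans (closure_mono ?_) hsub)⟩
  · refine Metric.mem_closure_iff.2 fun ε hε => ?_
    obtain ⟨L, o, hL, -, t, ht, htz⟩ :=
      J.exists_rLimit_of_mem_essentialSpectrum hT hd hG hz (half_pos hε)
    -- The limit lives on T itself.
    refine ⟨t, ⟨V, T, inferInstance, hG, L, o, hT.connected, hL, ht⟩, ?_⟩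
    rw [dist_comm]
    linarith
  · refine Metric.mem_closure_iff.2 fun ε hε => ?_
    obtain ⟨L, o, hL, hpos, t, ht, htz⟩ :=
      J.exists_rLimit_of_mem_essentialSpectrum hT hd hG hz (half_pos hε)
    refine ⟨t, ⟨V, T, inferInstance, hG, L, o, hT.connected,
      fun u v h => hc.trans_le (hpos c hcJ u v h), hL, ht⟩, ?_⟩
    rw [dist_comm]
    linarith
  · rintro z ⟨W, F, hLF, hF, L, w₀, hFc, -, hL, hz⟩
    exact ⟨W, F, hLF, hF, L, w₀, hFc, hL, hz⟩
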